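/- A space means a nonempty compact metrizable space, with a metric $d$ chosen when one is needed (the notions below do not depend on the choice). For a relation $R\subset X\times X$ on a space $X$ let $\mathcal O R=\bigcup_{n\ge 1}R^n$, $\mathcal N R=\overline{\mathcal O R}$ and $\mathcal C R=\bigcap_{\epsilon>0}\mathcal O(\bar V_\epsilon\circ R\circ\bar V_\epsilon)$, where $\bar V_\epsilon=\{(x,y):d(x,y)\le\epsilon\}$. Call $R$ topologically transitive if $\mathcal N R=X\times X$ and chain transitive if $\mathcal C R=X\times X$; a map is identified with its graph. For a homeomorphism $f$ of $X$ put $f_\pm=f\cup 1_X\cup f^{-1}$, $\omega f(x)=\bigcap_{n}\overline{\{f^j(x):j\ge n\}}$ and $\alpha f(x)=\omega (f^{-1})(x)$. Let $X$ be a space. A point extension $X^i$ of $X$ is a space containing $X$ as a closed, nowhere dense subset such that every point of $X^i\setminus X$ is isolated in $X^i$. For a space $K$, a $K$-extension $X^{(K)}$ of $X$ is a space containing $X$ as a closed subset for which there are a point extension $X^i$ of $X$ and a continuous map $\pi:X^{(K)}\to X^i$ that is the identity on $X$, maps $X^{(K)}\setminus X$ into $X^i\setminus X$, and has $\pi^{-1}(z)$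 homeomorphic to $K$ for every isolated point $z$ of $X^i$. A Cantor set is a perfect, zero-dimensional space, and a Cantor set extension is a $K$-extension with $K$ a Cantor set. **Theorem 3.11.** Let $X$ and $K$ be spaces, $X^i$ a point extension of $X$, $X^c$ a Cantor set extension of $X$, and $X^{(K)}$ a $K$-extension of $X$. (a) If $f$ is a chain transitive homeomorphism on $X$, then there is a homeomorphism $F$ on $X^i$ which extends $f$ such that $F$ is chain transitive, $F_\pm$ is topologically transitive, and $\omega F(x)=X=\alpha F(x)$ for every $x\in X^i\setminus X$. In particular, $X$ is the omega limit set under $F$ of some point of $X^i$. (b) There is a topologically transitive homeomorphism on $X^c$ which extends $1_X$. (c) There is a chain transitive homeomorphism on $X^{(K)}$ which extends $1_X$. -/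

import Mathlib

open Set Filter Topology

/-! ### Dynamics of relations -/

section RelationDynamics

variable {X : Type*}

/-- The orbit relation of `R`: the union of the compositional powers `R ^ n`, `n ≥ 1`,
that is, the transitive closure of `R`. -/
def orbitRel (R : SetRel X X) : SetRel X X :=
  {p | Relation.TransGen (fun x y => (x, y) ∈ R) p.1 p.2}

/-- The wandering relation of `R`: the closure in `X × X` of the orbit relation. -/
def wanderingRel [TopologicalSpace X] (R : SetRel X X) : SetRel X X :=
  closure (orbitRel R)

/-- The relation of being at distance at most `ε`. -/
def closedBallRel (X : Type*) [MetricSpace X] (ε : ℝ) : SetRel X X :=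
  {p | dist p.1 p.2 ≤ ε}

/-- The chain relation of `R`: the intersection over `ε > 0` of the orbit relations of
`V ∘ R ∘ V`, where `V` is the relation of being at distance at most `ε`. -/
def chainRel [MetricSpace X] (R : SetRel X X) : SetRel X X :=
  ⋂ (ε : ℝ) (_ : 0 < ε), orbitRel (((closedBallRel X ε).comp R).comp (closedBallRel X ε))

/-- `R` is topologically transitive when its wandering relation is all of `X × X`. -/
def IsTopTransitive [TopologicalSpace X] (R : SetRel X X) : Prop :=
  wanderingRel R = univ

/-- `R` is chain transitive when its chain relation is all of `X × X`. -/
def IsChainTransitive [MetricSpace X] (R : SetRel X X) : Prop :=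
  chainRel R = univ

/-- A map regarded as a relation. -/
def mapRel (f : X → X) : SetRel X X := {p | f p.1 = p.2}

/-- The reflexive and symmetric relation `R ∪ 1 ∪ R⁻¹`. -/
def pmRel (R : SetRel X X) : SetRel X X := R ∪ SetRel.id ∪ R.inv

/-- The omega limit set of the point `x` for the map `f`, i.e. `⋂ₙ closure {f^i x : i ≥ n}`. -/
def omegaLimitPt [TopologicalSpace X] (f : X → X) (x : X) : Set X :=
  omegaLimit atTop (fun (n : ℕ) (y : X) => f^[n] y) {x}

/-- The alpha limit set of a point for a homeomorphism: the omega limit set for the inverse. -/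
def alphaLimitPt [TopologicalSpace X] (f : X ≃ₜ X) (x : X) : Set X :=
  omegaLimitPt f.symm x

end RelationDynamics

/-! ### Extensions

A pair consisting of a space `Y` and a closed subset homeomorphic to `X` is presented by the
closed embedding `X → Y`; the subset is the range of the embedding. -/

section Extensions

universe u v w

/-- `e` exhibits `Y` as a point extension of `X`: the copy of `X` in `Y` is closed and nowhere
dense and every point of its complement is isolated in `Y`. -/
structure IsPointExtension {X : Type u} {Y : Type v} [TopologicalSpace X] [TopologicalSpace Y]
    (e : X → Y) : Prop where
  isClosedEmbedding : IsClosedEmbedding e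
  isNowhereDense : IsNowhereDense (range e)
  isolated : ∀ y, y ∉ range e → IsOpen ({y} : Set Y)

/-- `π` is a map of pairs rel `X` from `e : X → Y` to `i : X → Z`: it is continuous, restricts to
the identity on `X` and maps the complement of `X` in `Y` to the complement of `X` in `Z`. -/
structure IsMapRel {X : Type u} {Y : Type v} {Z : Type w} [TopologicalSpace Y]
    [TopologicalSpace Z] (e : X → Y) (i : X → Z) (π : Y → Z) : Prop where
  continuous : Continuous π
  map_base : ∀ x, π (e x) = i x
  map_compl : ∀ y, y ∉ range e → π y ∉ range i

/-- `e` exhibits `Y` as a `K`-extension of `X`: the copy of `X` in `Y` is closed, and for some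
(compact metrizable) point extension `i : X → Z` there is a map rel `X` from `Y` to `Z` whose
fibre over each isolated point of `Z` is homeomorphic to `K`. (If `K` is nonempty, such a map is
onto, so it is no restriction that `Z` is taken in the same universe as `Y`.) -/
def IsKExtension (K : Type w) {X : Type u} {Y : Type v} [TopologicalSpace K]
    [TopologicalSpace X] [TopologicalSpace Y] (e : X → Y) : Prop :=
  IsClosedEmbedding e ∧
  ∃ (Z : Type v) (_ : TopologicalSpace Z) (_ : CompactSpace Z)
    (_ : TopologicalSpace.MetrizableSpace Z) (i : X → Z) (π : Y → Z),
    IsPointExtension i ∧ IsMapRel e i π ∧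
    ∀ z : Z, IsOpen ({z} : Set Z) → Nonempty (π ⁻¹' {z} ≃ₜ K)

/-- A Cantor set is a nonempty compact metrizable space that is perfect (it has no isolated
points) and zero-dimensional (the clopen sets form a base of the topology). -/
structure IsCantorSpace (C : Type w) [TopologicalSpace C] : Prop where
  nonempty : Nonempty C
  compact : CompactSpace C
  metrizable : TopologicalSpace.MetrizableSpace C
  perfect : PerfectSpace C
  zeroDim : TopologicalSpace.IsTopologicalBasis {s : Set C | IsClopen s}

end Extensions

/-! All three parts share one scheme. Let D be the discrete set of isolated points of the underlying
point extension; the complement of X in the extension is then D × K. Near X the topology is pulled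
back from the point extension (`IsMapRel.nhds_base`), so a continuous permutation of D × K extends a
homeomorphism f of X as soon as its D-coordinate follows f near X (`IsMapRel.exists_homeomorph`).

For (a) and (c), D is indexed by bi-infinite pseudo-orbits in X, each isolated point lying close to
its pseudo-orbit point with errors tending to 0 (`IsPointExtension.exists_equiv`), and the map
advances the time index. In (a) a single pseudo-orbit, concatenated from ever finer chains, is dense
in both time directions. In (c) a dense sequence of X is joined into a tree whose edge lengths tend
to 0 (`exists_nearest_earlier`), and for each edge and direction one orbit crosses it.

For (b) the fibre is (ℕ → Bool)^ℤ by Brouwer's theorem, and the map is a skew product over the full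
shift: the letter read applies at most one transposition to D, along an edge of such a tree on D.
Displacements shrink near X, so the identity of X extends; the freedom to insert words gives
transitivity (`exists_skewShift_iterate_mem`). -/

/-! ### Brouwer's characterization of the Cantor set -/

section Brouwer

variable {C : Type*}

/-- If `B` cuts `A`, then `B` itself splits `A`. Otherwise every subset of `A` is already decided by
`B`, and perfectness provides a second point to separate off. -/
theorem exists_clopen_splitting [TopologicalSpace C]
    (hb : TopologicalSpace.IsTopologicalBasis {s : Set C | IsClopen s})
    [T1Space C] [PerfectSpace C] {A B : Set C} (hA : IsClopen A) (hne : A.Nonempty)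
    (hB : IsClopen B) :
    ∃ S, IsClopen S ∧ S ⊆ A ∧ S.Nonempty ∧ (A \ S).Nonempty ∧
      (S ⊆ B ∨ Disjoint S B) ∧ (A \ S ⊆ B ∨ Disjoint (A \ S) B) := by
  by_cases h : (A ∩ B).Nonempty ∧ (A \ B).Nonempty
  · refine ⟨A ∩ B, hA.inter hB, inter_subset_left, h.1, ?_, Or.inl inter_subset_right, Or.inr ?_⟩
    · rw [sdiff_self_inter]; exact h.2
    · rw [sdiff_self_inter]; exact disjoint_sdiff_left
  · have hd : A ⊆ B ∨ Disjoint A B := by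
      by_cases h1 : (A ∩ B).Nonempty
      · left
        rw [← sdiff_eq_empty]
        exact not_nonempty_iff_eq_empty.1 fun h2 => h ⟨h1, h2⟩
      · right
        exact disjoint_iff_inter_eq_empty.2 (not_nonempty_iff_eq_empty.1 h1)
    obtain ⟨x, hx⟩ := hne
    obtain ⟨y, hyA, hyx⟩ : ∃ y ∈ A, y ≠ x := by
      obtain ⟨y, hy1, hy2⟩ := (PerfectSpace.not_isolated x).nonempty_of_mem
        (inter_mem_nhdsWithin _ (hA.isOpen.mem_nhds hx))
      exact ⟨y, hy2, hy1⟩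
    obtain ⟨V, hV, hxV, hVs⟩ := hb.exists_subset_of_mem_open (a := x) (u := A \ {y})
      ⟨hx, fun h => hyx (mem_singleton_iff.1 h).symm⟩ (hA.isOpen.sdiff isClosed_singleton)
    refine ⟨V, hV, hVs.trans sdiff_subset, ⟨x, hxV⟩, ⟨y, hyA, fun h => (hVs h).2 rfl⟩, ?_, ?_⟩
    · exact hd.imp (hVs.trans sdiff_subset).trans (Disjoint.mono_left (hVs.trans sdiff_subset))
    · exact hd.imp sdiff_subset.trans (Disjoint.mono_left sdiff_subset)

/-- The set reached after `n` splittings by `s`, following the branch `b`. -/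
def branchSet (s : Set C → ℕ → Set C) (b : ℕ → Bool) : ℕ → Set C
  | 0 => univ
  | n + 1 => if b n then s (branchSet s b n) n else branchSet s b n \ s (branchSet s b n) n

theorem branchSet_congr (s : Set C → ℕ → Set C) {b b' : ℕ → Bool} {n : ℕ}
    (h : ∀ k < n, b k = b' k) : branchSet s b n = branchSet s b' n := by
  induction n with
  | zero => rfl
  | succ n ih =>
    simp only [branchSet, ih fun k hk => h k (hk.trans n.lt_succ_self), h n n.lt_succ_self]

open Classical in
/-- The set containing `x` after `n` splittings by `s`. -/
noncomputable def pointSet (s : Set C → ℕ → Set C) (x : C) : ℕ → Set C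
  | 0 => univ
  | n + 1 => if x ∈ s (pointSet s x n) n then s (pointSet s x n) n
      else pointSet s x n \ s (pointSet s x n) n

theorem mem_pointSet (s : Set C → ℕ → Set C) (x : C) (n : ℕ) : x ∈ pointSet s x n := by
  induction n with
  | zero => trivial
  | succ n ih =>
    simp only [pointSet]
    split_ifs with h
    · exact h
    · exact ⟨ih, h⟩

/-- Universal splitting scheme: the `n`-th splitting decides the `n`-th set of a countable clopen
base, so each branch shrinks to a single point, and the nested pieces are nonempty compact. -/
theorem IsCantorSpace.nonempty_homeomorph [TopologicalSpace C] (hC : IsCantorSpace C) :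
    Nonempty ((ℕ → Bool) ≃ₜ C) := by
  classical
  have := hC.nonempty
  have := hC.compact
  have := hC.metrizable
  have := hC.perfect
  let _ := TopologicalSpace.metrizableSpaceMetric C
  obtain ⟨b0, hb0, hb0c, hb0b⟩ := hC.zeroDim.exists_countable
  have hb0ne : b0.Nonempty := by
    by_contra h
    rw [not_nonempty_iff_eq_empty] at h
    obtain ⟨V, hV, -⟩ := hb0b.exists_subset_of_mem_open (mem_univ (Classical.arbitrary C))
      isOpen_univ
    rw [h] at hV
    exact hV
  obtain ⟨B, rfl⟩ := hb0c.exists_eq_range hb0ne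
  have hBc : ∀ n, IsClopen (B n) := fun n => hb0 (mem_range_self n)
  have hsplit : ∀ (A : Set C) (n : ℕ), ∃ S, IsClopen A → A.Nonempty →
      IsClopen S ∧ S ⊆ A ∧ S.Nonempty ∧ (A \ S).Nonempty ∧
      (S ⊆ B n ∨ Disjoint S (B n)) ∧ (A \ S ⊆ B n ∨ Disjoint (A \ S) (B n)) := by
    intro A n
    by_cases h : IsClopen A ∧ A.Nonempty
    · obtain ⟨S, hS⟩ := exists_clopen_splitting hC.zeroDim h.1 h.2 (hBc n)
      exact ⟨S, fun _ _ => hS⟩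
    · exact ⟨∅, fun h1 h2 => (h ⟨h1, h2⟩).elim⟩
  choose s hs using hsplit
  have hA : ∀ b n, IsClopen (branchSet s b n) ∧ (branchSet s b n).Nonempty := by
    intro b n
    induction n with
    | zero => exact ⟨isClopen_univ, univ_nonempty⟩
    | succ n ih =>
      obtain ⟨h1, h2, h3, h4, -, -⟩ := hs _ n ih.1 ih.2
      simp only [branchSet]
      split_ifs
      · exact ⟨h1, h3⟩
      · exact ⟨ih.1.diff h1, h4⟩
  have hsub : ∀ b n, branchSet s b (n + 1) ⊆ branchSet s b n := by
    intro b n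
    simp only [branchSet]
    split_ifs
    · exact (hs _ n (hA b n).1 (hA b n).2).2.1
    · exact sdiff_subset
  have hdec : ∀ b n, branchSet s b (n + 1) ⊆ B n ∨ Disjoint (branchSet s b (n + 1)) (B n) := by
    intro b n
    obtain ⟨-, -, -, -, h1, h2⟩ := hs _ n (hA b n).1 (hA b n).2
    simp only [branchSet]
    split_ifs
    · exact h1
    · exact h2
  have hInter : ∀ b, (⋂ n, branchSet s b n).Nonempty := fun b =>
    IsCompact.nonempty_iInter_of_sequence_nonempty_isCompact_isClosed _ (hsub b)
      (fun n => (hA b n).2) (hA b 0).1.isClosed.isCompact fun n => (hA b n).1.isClosed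
  choose h hh using hInter
  simp only [mem_iInter] at hh
  have hdet : ∀ b n, h b ∈ B n → branchSet s b (n + 1) ⊆ B n := fun b n hb =>
    (hdec b n).resolve_right fun hd => hd.ne_of_mem (hh b (n + 1)) hb rfl
  have hcont : Continuous h := by
    rw [continuous_iff_continuousAt]
    intro b U hU
    rw [mem_map]
    obtain ⟨_, ⟨n, rfl⟩, hbn, hnU⟩ := hb0b.mem_nhds_iff.1 hU
    have hev : ∀ᶠ b' in 𝓝 b, ∀ k < n + 1, b k = b' k := by
      refine (eventually_all_finite (Set.finite_lt_nat (n + 1))).2 fun k _ => ?_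
      have : Tendsto (fun b' : ℕ → Bool => b' k) (𝓝 b) (𝓝 (b k)) := (continuous_apply k).tendsto b
      rw [nhds_discrete Bool, tendsto_pure] at this
      exact this.mono fun b' h => h.symm
    filter_upwards [hev] with b' hb'
    refine hnU (hdet b n hbn ?_)
    rw [branchSet_congr s hb']
    exact hh b' (n + 1)
  have hinj : Function.Injective h := by
    intro b b' hbb
    have key : ∀ n, ∀ k < n, b k = b' k := by
      intro n
      induction n with
      | zero => intro k hk; omega
      | succ n ih =>
        intro k hk
        rcases Nat.lt_succ_iff_lt_or_eq.1 hk with hk | rfl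
        · exact ih k hk
        · have h1 := hh b (k + 1)
          have h2 := hh b' (k + 1)
          rw [← hbb] at h2
          simp only [branchSet, branchSet_congr s ih] at h1 h2
          cases hb : b k <;> cases hb' : b' k <;> simp_all
    exact funext fun k => key (k + 1) k k.lt_succ_self
  have hsurj : Function.Surjective h := by
    intro x
    -- The branch that always turns towards `x`; `pointSet` tracks its sets without mentioning the
    -- branch, which avoids circularity.
    refine ⟨fun n => decide (x ∈ s (pointSet s x n) n), ?_⟩
    set b : ℕ → Bool := fun n => decide (x ∈ s (pointSet s x n) n)
    have hb : ∀ n, b n = decide (x ∈ s (pointSet s x n) n) := fun n => rfl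
    have hAx : ∀ n, branchSet s b n = pointSet s x n := by
      intro n
      induction n with
      | zero => rfl
      | succ n ih => simp only [branchSet, pointSet, ih, hb, decide_eq_true_eq]
    by_contra hne
    obtain ⟨_, ⟨n, rfl⟩, hbn, hnU⟩ := hb0b.mem_nhds_iff.1
      (isOpen_compl_singleton.mem_nhds (show h b ∈ ({x} : Set C)ᶜ from hne))
    exact hnU (hdet b n hbn (hAx (n + 1) ▸ mem_pointSet s x (n + 1))) rfl
  exact ⟨Continuous.homeoOfEquivCompactToT2 (f := Equiv.ofBijective h ⟨hinj, hsurj⟩) hcont⟩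

end Brouwer

/-- Every Cantor space is homeomorphic to the space of bi-infinite sequences in `ℕ → Bool`. -/
theorem IsCantorSpace.nonempty_homeomorph_int {C : Type*} [TopologicalSpace C]
    (hC : IsCantorSpace C) : Nonempty (C ≃ₜ (ℤ → ℕ → Bool)) := by
  obtain ⟨h⟩ := hC.nonempty_homeomorph
  exact ⟨h.symm.trans (cantorSpaceHomeomorphNatToCantorSpace.trans
    (Homeomorph.piCongrLeft (Y := fun _ : ℤ => ℕ → Bool) (Denumerable.eqv ℤ).symm))⟩

/-! ### Homeomorphisms of extensions -/

section Extensions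

variable {X Y Z K : Type*} [TopologicalSpace Y] [TopologicalSpace Z]
  {e : X → Y} {i : X → Z} {π : Y → Z}

theorem isMapRel_id (i : X → Z) : IsMapRel i i id :=
  ⟨continuous_id, fun _ => rfl, fun _ hy => hy⟩

theorem IsMapRel.preimage_base (h : IsMapRel e i π) (hi : Function.Injective i) (x : X) :
    π ⁻¹' {i x} = {e x} := by
  ext y
  simp only [mem_preimage, mem_singleton_iff]
  constructor
  · intro hy
    by_cases hr : y ∈ range e
    · obtain ⟨x', rfl⟩ := hr
      rw [h.map_base] at hy
      rw [hi hy]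
    · exact (h.map_compl y hr ⟨x, hy.symm⟩).elim
  · rintro rfl
    exact h.map_base x

/-- `π` is a closed map and its fibre over a point of X is a single point. Convergence to X can
therefore be tested in `Z`, whatever happens inside the fibres. -/
theorem IsMapRel.nhds_base [CompactSpace Y] [T2Space Z] (h : IsMapRel e i π)
    (hi : Function.Injective i) (x : X) : 𝓝 (e x) = comap π (𝓝 (i x)) := by
  rw [h.continuous.isClosedMap.comap_nhds_eq h.continuous, h.preimage_base hi, nhdsSet_singleton]

variable [TopologicalSpace X] [TopologicalSpace K]

theorem IsPointExtension.discreteTopology (hi : IsPointExtension i) :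
    DiscreteTopology ↥(range i)ᶜ := by
  refine discreteTopology_iff_isOpen_singleton.2 fun d => ?_
  have : ({d} : Set ↥(range i)ᶜ) = Subtype.val ⁻¹' {(d : Z)} := by
    ext d'
    rw [mem_preimage, mem_singleton_iff, mem_singleton_iff, Subtype.ext_iff]
  rw [this]
  exact (hi.isolated d d.2).preimage continuous_subtype_val

/-- Fibres over isolated points are open, so arbitrarily chosen homeomorphisms with `K` glue without
any compatibility condition. -/
theorem IsMapRel.exists_trivialization (h : IsMapRel e i π) (hi : IsPointExtension i)
    (hK : ∀ z : Z, IsOpen ({z} : Set Z) → Nonempty (π ⁻¹' {z} ≃ₜ K)) :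
    ∃ ψ : ↥(range i)ᶜ × K → Y, IsOpenEmbedding ψ ∧ range ψ = (range e)ᶜ ∧
      ∀ p, π (ψ p) = p.1 := by
  have := hi.discreteTopology
  obtain ⟨φ⟩ : Nonempty (∀ d : ↥(range i)ᶜ, π ⁻¹' {(d : Z)} ≃ₜ K) :=
    ⟨fun d => (hK d (hi.isolated d d.2)).some⟩
  have hπ : ∀ p : ↥(range i)ᶜ × K, π ((φ p.1).symm p.2 : Y) = p.1 := fun p =>
    ((φ p.1).symm p.2).2
  refine ⟨fun p => ((φ p.1).symm p.2 : Y), ?_, ?_, hπ⟩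
  · refine IsOpenEmbedding.of_continuous_injective_isOpenMap ?_ ?_ ?_
    · rw [continuous_prod_of_discrete_left]
      exact fun d => continuous_subtype_val.comp (φ d).symm.continuous
    · rintro ⟨d, k⟩ ⟨d', k'⟩ hp
      have hd : d = d' := by
        have := congrArg π hp
        rw [hπ, hπ] at this
        exact Subtype.ext this
      subst hd
      exact Prod.ext rfl ((φ d).symm.injective (Subtype.ext hp))
    · intro U hU
      have : (fun p : ↥(range i)ᶜ × K => ((φ p.1).symm p.2 : Y)) '' U =
          ⋃ d : ↥(range i)ᶜ, Subtype.val '' ((φ d).symm '' {k | (d, k) ∈ U}) := by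
        ext y
        simp only [mem_image, Prod.exists, mem_iUnion]
        constructor
        · rintro ⟨d, k, hdk, rfl⟩
          exact ⟨d, _, ⟨k, hdk, rfl⟩, rfl⟩
        · rintro ⟨d, _, ⟨k, hdk, rfl⟩, rfl⟩
          exact ⟨d, k, hdk, rfl⟩
      rw [this]
      refine isOpen_iUnion fun d => ?_
      refine ((hi.isolated d d.2).preimage h.continuous).isOpenMap_subtype_val _ ?_
      refine (φ d).symm.isOpenMap _ (hU.preimage ?_)
      fun_prop
  · ext y
    constructor
    · rintro ⟨p, rfl⟩ ⟨x, hx⟩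
      have h1 := hπ p
      simp only at hx
      rw [← hx, h.map_base] at h1
      exact p.1.2 ⟨x, h1⟩
    · intro hy
      exact ⟨(⟨π y, h.map_compl y hy⟩, φ ⟨π y, h.map_compl y hy⟩ ⟨y, rfl⟩), by simp⟩

/-- A homeomorphism of `X` together with a bijection of the complement of `X` extends to the
whole space when the latter is continuous and asymptotically follows the former. -/
theorem IsMapRel.exists_homeomorph [CompactSpace Y] [T2Space Y] [T2Space Z] (h : IsMapRel e i π)
    (hi : IsPointExtension i) (he : IsClosedEmbedding e) {ψ : ↥(range i)ᶜ × K → Y}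
    (hψ : IsOpenEmbedding ψ) (hr : range ψ = (range e)ᶜ) (hπ : ∀ p, π (ψ p) = p.1) (f : X ≃ₜ X)
    (g : ↥(range i)ᶜ × K ≃ ↥(range i)ᶜ × K) (hg : Continuous g)
    (hlim : ∀ x, Tendsto (fun p => ((g p).1 : Z))
      (comap (fun p : ↥(range i)ᶜ × K => (p.1 : Z)) (𝓝 (i x))) (𝓝 (i (f x)))) :
    ∃ G : Y ≃ₜ Y, (∀ x, G (e x) = e (f x)) ∧ ∀ p, G (ψ p) = ψ (g p) := by
  have hcover : ∀ y, (∃ x, e x = y) ∨ ∃ p, ψ p = y := by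
    intro y
    by_cases hy : y ∈ range e
    · exact Or.inl hy
    · exact Or.inr ((hr ▸ hy : y ∈ range ψ))
  have hdisj : ∀ x p, e x ≠ ψ p := fun x p hxp => by
    have : ψ p ∈ (range e)ᶜ := hr ▸ mem_range_self p
    exact this ⟨x, hxp⟩
  have hbij : Function.Bijective (Sum.elim e ψ) := by
    refine ⟨he.injective.sumElim hψ.injective hdisj, fun y => ?_⟩
    rcases hcover y with ⟨x, rfl⟩ | ⟨p, rfl⟩
    · exact ⟨Sum.inl x, rfl⟩
    · exact ⟨Sum.inr p, rfl⟩
  let T := Equiv.ofBijective _ hbij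
  let G : Y ≃ Y := T.symm.trans ((Equiv.sumCongr f.toEquiv g).trans T)
  have hGe : ∀ x, G (e x) = e (f x) := by
    intro x
    have : T.symm (e x) = Sum.inl x := T.symm_apply_eq.2 rfl
    simp [G, this, T]
  have hGψ : ∀ p, G (ψ p) = ψ (g p) := by
    intro p
    have : T.symm (ψ p) = Sum.inr p := T.symm_apply_eq.2 rfl
    simp [G, this, T]
  have hG : Continuous G := by
    rw [continuous_iff_continuousAt]
    intro y
    rcases hcover y with ⟨x, rfl⟩ | ⟨p, rfl⟩
    · have hi' := hi.isClosedEmbedding.injective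
      rw [ContinuousAt, hGe, h.nhds_base hi', h.nhds_base hi', tendsto_comap_iff]
      intro V hV
      obtain ⟨W, hW, hWV⟩ := mem_comap.1 (hlim x hV)
      have h2 : Tendsto (fun x' => i (f x')) (comap i (𝓝 (i x))) (𝓝 (i (f x))) := by
        rw [← hi.isClosedEmbedding.isInducing.nhds_eq_comap]
        exact (hi.isClosedEmbedding.continuous.comp f.continuous).tendsto x
      obtain ⟨W', hW', hWV'⟩ := mem_comap.1 (h2 hV)
      refine mem_comap.2 ⟨W ∩ W', inter_mem hW hW', ?_⟩
      rintro y ⟨hy, hy'⟩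
      rcases hcover y with ⟨x', rfl⟩ | ⟨p, rfl⟩
      · rw [h.map_base] at hy'
        simpa [hGe, h.map_base] using hWV' hy'
      · rw [hπ] at hy
        simpa [hGψ, hπ] using hWV hy
    · rw [← hψ.continuousAt_iff]
      have : G ∘ ψ = ψ ∘ g := funext hGψ
      rw [this]
      exact (hψ.continuous.comp hg).continuousAt
  exact ⟨hG.homeoOfEquivCompactToT2, hGe, hGψ⟩

end Extensions

/-! ### Isolated points of a point extension -/

section PointExtensions

theorem exists_injective_mem {A B : Type*} [Countable A] [Countable B] [Infinite B]
    (S : A → Set B) (hS : ∀ a, (S a).Infinite) :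
    ∃ g : A → B, Function.Injective g ∧ ∀ a, g a ∈ S a := by
  obtain ⟨enc, henc⟩ := Countable.exists_injective_nat A
  obtain ⟨hB⟩ := nonempty_denumerable B
  let b : B ≃ ℕ := Denumerable.eqv B
  -- Strictly increasing codes force injectivity; numbers that encode no element of `A` impose no
  -- condition.
  obtain ⟨φ, hφ, hφS⟩ := extraction_forall_of_frequently
    (P := fun n k => ∀ a, enc a = n → b.symm k ∈ S a) <| by
      intro n
      rw [Nat.frequently_atTop_iff_infinite]
      by_cases hn : ∃ a, enc a = n
      · obtain ⟨a, rfl⟩ := hn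
        refine ((hS a).image b.injective.injOn).mono ?_
        rintro _ ⟨x, hx, rfl⟩ a' ha'
        rw [henc ha', Equiv.symm_apply_apply]
        exact hx
      · refine infinite_univ.mono fun k _ a ha => (hn ⟨a, ha⟩).elim
  exact ⟨fun a => b.symm (φ (enc a)), fun a a' h => henc (hφ.injective (b.symm.injective h)),
    fun a => hφS _ a rfl⟩

theorem exists_pos_tendsto_cofinite_zero (A : Type*) [Countable A] :
    ∃ u : A → ℝ, (∀ a, 0 < u a) ∧ Tendsto u cofinite (𝓝 0) := by
  obtain ⟨enc, henc⟩ := Countable.exists_injective_nat A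
  refine ⟨fun a => 1 / ((enc a : ℝ) + 1), fun a => by positivity, ?_⟩
  refine tendsto_one_div_add_atTop_nhds_zero_nat.comp ?_
  rw [← Nat.cofinite_eq_atTop]
  exact henc.tendsto_cofinite

variable {X Z : Type*} [MetricSpace Z] {i : X → Z}

theorem comap_coe_nhds_le_cofinite (x : X) :
    comap (fun d : ↥(range i)ᶜ => (d : Z)) (𝓝 (i x)) ≤ cofinite := by
  rw [le_cofinite_iff_compl_singleton_mem]
  intro d
  refine mem_comap.2 ⟨{(d : Z)}ᶜ, isOpen_compl_singleton.mem_nhds ?_, ?_⟩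
  · intro h
    exact d.2 ⟨x, h⟩
  · intro d' h h'
    exact h (congrArg Subtype.val h')

variable [TopologicalSpace X]

theorem IsPointExtension.countable [CompactSpace Z] (hi : IsPointExtension i) :
    Countable ↥(range i)ᶜ := by
  have := hi.discreteTopology
  exact TopologicalSpace.separableSpace_iff_countable.1 inferInstance

theorem IsPointExtension.tendsto_infDist [CompactSpace Z] (hi : IsPointExtension i) :
    Tendsto (fun d : ↥(range i)ᶜ => Metric.infDist (d : Z) (range i)) cofinite (𝓝 0) := by
  rw [Metric.tendsto_nhds]
  intro ε hε
  rw [eventually_cofinite]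
  have := hi.discreteTopology
  refine IsCompact.finite_of_discrete (Subtype.isCompact_iff.2 ?_)
  have : Subtype.val '' {d : ↥(range i)ᶜ | ¬ dist (Metric.infDist (d : Z) (range i)) 0 < ε} =
      {z : Z | ε ≤ Metric.infDist z (range i)} := by
    ext z
    simp only [Real.dist_0_eq_abs, abs_of_nonneg Metric.infDist_nonneg, not_lt, mem_image,
      mem_ofPred_eq]
    constructor
    · rintro ⟨d, hd, rfl⟩
      exact hd
    · intro hz
      refine ⟨⟨z, fun h => ?_⟩, hz, rfl⟩
      rw [Metric.infDist_zero_of_mem h] at hz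
      exact absurd hz (not_le.2 hε)
  rw [this]
  exact (isClosed_le continuous_const (Metric.continuous_infDist_pt _)).isCompact

/-- Were there finitely many, deleting them from the ball would leave a neighbourhood of `i x`
inside the closure of X, against nowhere density. -/
theorem IsPointExtension.infinite_dist_lt (hi : IsPointExtension i) (x : X) {ε : ℝ}
    (hε : 0 < ε) : {d : ↥(range i)ᶜ | dist (d : Z) (i x) < ε}.Infinite := by
  intro hfin
  have hF : (Subtype.val '' {d : ↥(range i)ᶜ | dist (d : Z) (i x) < ε}).Finite := hfin.image _
  have hO : IsOpen (Metric.ball (i x) ε \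
      (Subtype.val '' {d : ↥(range i)ᶜ | dist (d : Z) (i x) < ε})) :=
    Metric.isOpen_ball.sdiff hF.isClosed
  have hsub : Metric.ball (i x) ε \
      (Subtype.val '' {d : ↥(range i)ᶜ | dist (d : Z) (i x) < ε}) ⊆ closure (range i) := by
    rintro z ⟨hz, hz'⟩
    by_contra h
    have h' : z ∉ range i := fun h' => h (subset_closure h')
    exact hz' ⟨⟨z, h'⟩, hz, rfl⟩
  have hx : i x ∈ interior (closure (range i)) := by
    refine interior_maximal hsub hO ⟨Metric.mem_ball_self hε, ?_⟩
    rintro ⟨d, -, hd⟩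
    exact d.2 ⟨x, hd.symm⟩
  rw [hi.isNowhereDense] at hx
  exact hx

theorem IsPointExtension.infinite [Nonempty X] (hi : IsPointExtension i) :
    Infinite ↥(range i)ᶜ := by
  have := (hi.infinite_dist_lt (Classical.arbitrary X) one_pos)
  exact infinite_univ_iff.1 (this.mono (subset_univ _))

/-- A back-and-forth matching: each isolated point has infinitely many admissible indices and each
index infinitely many admissible isolated points. Injections both ways yield, by Schröder–Bernstein,
a bijection consisting of admissible pairs. -/
theorem IsPointExtension.exists_equiv [CompactSpace Z] [Nonempty X] (hi : IsPointExtension i)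
    {J : Type*} [Countable J] (ρ : J → X)
    (hρ : ∀ x ε, 0 < ε → {j | dist (i (ρ j)) (i x) < ε}.Infinite) :
    ∃ φ : ↥(range i)ᶜ ≃ J, Tendsto (fun d : ↥(range i)ᶜ => dist (d : Z) (i (ρ (φ d)))) cofinite (𝓝 0) := by
  have := hi.countable
  have := hi.infinite
  have : Infinite J := infinite_univ_iff.1
    ((hρ (Classical.arbitrary X) 1 one_pos).mono (subset_univ _))
  obtain ⟨u, hu, hu0⟩ := exists_pos_tendsto_cofinite_zero ↥(range i)ᶜ
  obtain ⟨v, hv, hv0⟩ := exists_pos_tendsto_cofinite_zero J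
  -- The slack `u d` serves when `d` selects an index, `v j` when `j` selects a point; the whole
  -- bound tends to 0 along any bijection.
  let S : ↥(range i)ᶜ → J → Prop := fun d j =>
    dist (d : Z) (i (ρ j)) < Metric.infDist (d : Z) (range i) + u d + v j
  obtain ⟨g, hg, hgS⟩ := exists_injective_mem (fun d : ↥(range i)ᶜ => {j | S d j}) <| by
    intro d
    obtain ⟨_, ⟨x, rfl⟩, hx⟩ := (Metric.infDist_lt_iff (range_nonempty i)).1
      (lt_add_of_pos_right (Metric.infDist (d : Z) (range i)) (hu d))
    refine (hρ x _ (sub_pos.2 hx)).mono fun j hj => ?_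
    have h1 := dist_triangle_right (d : Z) (i (ρ j)) (i x)
    have h2 := hv j
    simp only [mem_ofPred_eq, S] at hj ⊢
    linarith
  obtain ⟨h, hh, hhS⟩ := exists_injective_mem (fun j : J => {d : ↥(range i)ᶜ | S d j}) <| by
    intro j
    refine (hi.infinite_dist_lt (ρ j) (hv j)).mono fun d hd => ?_
    have h1 := hu d
    have h2 := Metric.infDist_nonneg (x := (d : Z)) (s := range i)
    simp only [mem_ofPred_eq, S] at hd ⊢
    linarith
  obtain ⟨φ, hφ, hφS⟩ := Function.Embedding.schroeder_bernstein_of_rel hg hh S hgS hhS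
  refine ⟨Equiv.ofBijective φ hφ, ?_⟩
  have hlim := (hi.tendsto_infDist.add hu0).add (hv0.comp hφ.injective.tendsto_cofinite)
  simp only [add_zero] at hlim
  exact squeeze_zero (fun _ => dist_nonneg) (fun d : ↥(range i)ᶜ => (hφS d).le) hlim

end PointExtensions

/-- As `d` tends to `x`, so does its label in X; the label of the image is asymptotic to `f` of that
label, and the image point is asymptotic to its own label. -/
theorem IsPointExtension.tendsto_conj {X Z J : Type*} [MetricSpace X] [MetricSpace Z]
    {i : X → Z} (hi : IsPointExtension i) {ρ : J → X} {φ : ↥(range i)ᶜ ≃ J}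
    (hφ : Tendsto (fun d : ↥(range i)ᶜ => dist (d : Z) (i (ρ (φ d)))) cofinite (𝓝 0)) {f : X → X}
    (hf : Continuous f) (σ : J ≃ J)
    (hσ : Tendsto (fun j => dist (f (ρ j)) (ρ (σ j))) cofinite (𝓝 0)) (x : X) :
    Tendsto (fun d => ((φ.symm (σ (φ d)) : ↥(range i)ᶜ) : Z))
      (comap (fun d : ↥(range i)ᶜ => (d : Z)) (𝓝 (i x))) (𝓝 (i (f x))) := by
  have hF := comap_coe_nhds_le_cofinite (i := i) x
  have hi' := hi.isClosedEmbedding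
  have h1 : Tendsto (fun d => i (ρ (φ d)))
      (comap (fun d : ↥(range i)ᶜ => (d : Z)) (𝓝 (i x))) (𝓝 (i x)) :=
    tendsto_comap.congr_dist (hφ.mono_left hF)
  have h2 := hi'.isInducing.tendsto_nhds_iff.2 h1
  have h3 := ((hf.tendsto x).comp h2).congr_dist
    ((hσ.comp φ.injective.tendsto_cofinite).mono_left hF)
  have h4 := (hi'.continuous.tendsto _).comp h3
  refine h4.congr_dist ?_
  have h5 := (hφ.comp (((φ.trans σ).trans φ.symm).injective.tendsto_cofinite)).mono_left hF
  refine h5.congr fun d => ?_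
  simp [dist_comm]

/-! ### Chains -/

section Chains

/-- One step of an `ε`-chain of `f`. -/
def ChainStep {X : Type*} [MetricSpace X] (f : X → X) (ε : ℝ) (x y : X) : Prop :=
  ∃ p, dist x p ≤ ε ∧ dist (f p) y ≤ ε

variable {X Y : Type*} [MetricSpace X] [MetricSpace Y]

theorem isChainTransitive_mapRel_iff {f : X → X} :
    IsChainTransitive (mapRel f) ↔
      ∀ ε > 0, ∀ x y, Relation.TransGen (ChainStep f ε) x y := by
  have hstep : ∀ ε : ℝ, (fun x y => (x, y) ∈
      ((closedBallRel X ε).comp (mapRel f)).comp (closedBallRel X ε)) = ChainStep f ε := by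
    intro ε
    ext x y
    constructor
    · rintro ⟨q, ⟨p, h1, h3⟩, h2⟩
      have h3 : f p = q := h3
      exact ⟨p, h1, h3 ▸ h2⟩
    · rintro ⟨p, h1, h2⟩
      exact ⟨f p, ⟨p, h1, (rfl : f p = f p)⟩, h2⟩
  rw [IsChainTransitive, chainRel, eq_univ_iff_forall]
  simp only [mem_iInter, orbitRel, hstep, mem_ofPred_eq, Prod.forall]
  exact ⟨fun h ε hε x y => h x y ε hε, fun h x y ε hε => h ε hε x y⟩

theorem transGen_chainStep_of_iterate {f : X → X} {ε : ℝ} (hε : 0 ≤ ε) (n : ℕ) {x p y : X}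
    (hx : dist x p ≤ ε) (hy : dist (f^[n + 1] p) y ≤ ε) :
    Relation.TransGen (ChainStep f ε) x y := by
  induction n generalizing x p with
  | zero => exact .single ⟨p, hx, hy⟩
  | succ n ih =>
    refine .head ⟨p, hx, (dist_self _).trans_le hε⟩ (ih (p := f p) ((dist_self _).trans_le hε) ?_)
    rwa [← Function.iterate_succ_apply]

theorem transGen_chainStep_map [CompactSpace X] {f : X → X} {F : Y → Y} {e : X → Y}
    (he : Continuous e) (hF : ∀ x, F (e x) = e (f x)) (hf : IsChainTransitive (mapRel f))
    {ε : ℝ} (hε : 0 < ε) (x y : X) : Relation.TransGen (ChainStep F ε) (e x) (e y) := by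
  obtain ⟨δ, hδ, h⟩ := Metric.uniformContinuous_iff.1
    (CompactSpace.uniformContinuous_of_continuous he) ε hε
  refine (isChainTransitive_mapRel_iff.1 hf (δ / 2) (half_pos hδ) x y).lift e ?_
  rintro a b ⟨p, h1, h2⟩
  refine ⟨e p, (h (h1.trans_lt (half_lt_self hδ))).le, ?_⟩
  rw [hF]
  exact (h (h2.trans_lt (half_lt_self hδ))).le

end Chains

/-! ### Systems of bi-infinite orbits -/

/-- The complement of the range of `e` is swept out by orbits `j ↦ w ((l, j), k)` of `G` that are
asymptotic to the pseudo-orbits `j ↦ ρ (l, j)` in `X`. -/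
structure IsOrbitSystem {X Y L K : Type*} [MetricSpace Y] (e : X → Y) (ρ : L × ℤ → X)
    (G : Y → Y) (w : (L × ℤ) × K → Y) : Prop where
  map_orbit : ∀ l j k, G (w ((l, j), k)) = w ((l, j + 1), k)
  injective : Function.Injective w
  range_eq : range w = (range e)ᶜ
  tendsto : ∀ k, Tendsto (fun q => dist (w (q, k)) (e (ρ q))) cofinite (𝓝 0)

/-- Along an ultrafilter both families converge by compactness; the limits agree in `Z`, and the
fibre over a point of X is a singleton. -/
theorem IsMapRel.tendsto_dist {X Y Z ι : Type*} [TopologicalSpace X] [CompactSpace X]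
    [MetricSpace Y] [CompactSpace Y] [MetricSpace Z] {e : X → Y} {i : X → Z} {π : Y → Z}
    (h : IsMapRel e i π) (he : Continuous e) (hi : Continuous i) (hinj : Function.Injective i)
    {y : ι → Y} {ρ : ι → X} {l : Filter ι}
    (hl : Tendsto (fun q => dist (π (y q)) (i (ρ q))) l (𝓝 0)) :
    Tendsto (fun q => dist (y q) (e (ρ q))) l (𝓝 0) := by
  rw [tendsto_iff_ultrafilter] at hl ⊢
  intro U hU
  have hl := hl U hU
  obtain ⟨y0, -, hy0⟩ := isCompact_univ.ultrafilter_le_nhds (U.map y) (by simp)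
  obtain ⟨x0, -, hx0⟩ := isCompact_univ.ultrafilter_le_nhds (U.map ρ) (by simp)
  have hy : Tendsto y U (𝓝 y0) := hy0
  have hx : Tendsto ρ U (𝓝 x0) := hx0
  have h1 : Tendsto (fun q => i (ρ q)) U (𝓝 (π y0)) :=
    ((h.continuous.tendsto y0).comp hy).congr_dist hl
  have h2 : π y0 = i x0 := tendsto_nhds_unique h1 ((hi.tendsto x0).comp hx)
  have h3 : y0 = e x0 := by
    have : y0 ∈ π ⁻¹' {i x0} := h2
    rwa [h.preimage_base hinj] at this
  subst h3
  have := hy.dist ((he.tendsto x0).comp hx)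
  simpa using this

theorem IsMapRel.exists_isOrbitSystem {X Y Z K L : Type*} [MetricSpace X] [CompactSpace X]
    [Nonempty X] [MetricSpace Y] [CompactSpace Y] [MetricSpace Z] [CompactSpace Z]
    [TopologicalSpace K] [Countable L] {e : X → Y} {i : X → Z} {π : Y → Z}
    (h : IsMapRel e i π) (hi : IsPointExtension i) (he : IsClosedEmbedding e)
    (hK : ∀ z : Z, IsOpen ({z} : Set Z) → Nonempty (π ⁻¹' {z} ≃ₜ K)) (f : X ≃ₜ X)
    (ρ : L × ℤ → X) (hρ : ∀ x ε, 0 < ε → {q | dist (ρ q) x < ε}.Infinite)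
    (hfρ : Tendsto (fun q : L × ℤ => dist (f (ρ q)) (ρ (q.1, q.2 + 1))) cofinite (𝓝 0)) :
    ∃ (G : Y ≃ₜ Y) (w : (L × ℤ) × K → Y),
      (∀ x, G (e x) = e (f x)) ∧ IsOrbitSystem e ρ G w := by
  have hic := hi.isClosedEmbedding.continuous
  obtain ⟨ψ, hψ, hr, hπ⟩ := h.exists_trivialization hi hK
  obtain ⟨φ, hφ⟩ := hi.exists_equiv ρ <| by
    intro x ε hε
    obtain ⟨δ, hδ, hd⟩ := Metric.continuousAt_iff.1 hic.continuousAt ε hε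
    exact (hρ x δ hδ).mono fun q hq => hd hq
  let σ : L × ℤ ≃ L × ℤ := (Equiv.refl L).prodCongr (Equiv.addRight 1)
  have := hi.discreteTopology
  obtain ⟨G, hGe, hGψ⟩ := h.exists_homeomorph hi he hψ hr hπ f
    (((φ.trans σ).trans φ.symm).prodCongr (Equiv.refl K))
    (continuous_of_discreteTopology.prodMap continuous_id) <| by
      intro x
      have h1 := hi.tendsto_conj hφ f.continuous σ hfρ x
      have h2 : Tendsto (Prod.fst : ↥(range i)ᶜ × K → ↥(range i)ᶜ)
          (comap (fun p : ↥(range i)ᶜ × K => (p.1 : Z)) (𝓝 (i x)))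
          (comap (fun d : ↥(range i)ᶜ => (d : Z)) (𝓝 (i x))) :=
        tendsto_comap_iff.2 tendsto_comap
      exact h1.comp h2
  refine ⟨G, fun p => ψ (φ.symm p.1, p.2), hGe, ⟨?_, ?_, ?_, ?_⟩⟩
  · intro l j k
    rw [hGψ]
    simp [σ]
  · rintro ⟨q, k⟩ ⟨q', k'⟩ hp
    have := hψ.injective hp
    simpa using this
  · rw [← hr]
    exact (φ.symm.prodCongr (Equiv.refl K)).surjective.range_comp ψ
  · intro k
    refine h.tendsto_dist he.continuous hic hi.isClosedEmbedding.injective ?_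
    refine (hφ.comp φ.symm.injective.tendsto_cofinite).congr fun q => ?_
    simp [hπ]

section OrbitSystems

variable {X Y L K : Type*} [MetricSpace Y] {e : X → Y} {ρ : L × ℤ → X} {G : Y → Y}
  {w : (L × ℤ) × K → Y}

theorem IsOrbitSystem.iterate (h : IsOrbitSystem e ρ G w) (n : ℕ) (l : L) (j : ℤ) (k : K) :
    G^[n] (w ((l, j), k)) = w ((l, j + n), k) := by
  induction n with
  | zero => simp
  | succ n ih =>
    rw [Function.iterate_succ_apply', ih, h.map_orbit]
    push_cast
    rw [add_assoc]

theorem IsOrbitSystem.eventually_dist_le (h : IsOrbitSystem e ρ G w) (l : L) (k : K)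
    {ε : ℝ} (hε : 0 < ε) {s : ℕ → ℤ} (hs : Function.Injective s) :
    ∀ᶠ n in atTop, dist (w ((l, s n), k)) (e (ρ (l, s n))) ≤ ε := by
  have hinj : Function.Injective fun n => (l, s n) := fun a b hab => hs (Prod.ext_iff.1 hab).2
  have := (h.tendsto k).comp hinj.tendsto_cofinite
  rw [Nat.cofinite_eq_atTop] at this
  exact (this.eventually_lt_const hε).mono fun n hn => le_of_lt hn

/-- Both ends of every orbit outside X approach X, so any point can be chained into X and reached
from X. -/
theorem IsOrbitSystem.isChainTransitive (h : IsOrbitSystem e ρ G w)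
    (hX : ∀ ε > 0, ∀ x x', Relation.TransGen (ChainStep G ε) (e x) (e x')) :
    IsChainTransitive (mapRel G) := by
  rw [isChainTransitive_mapRel_iff]
  intro ε hε y y'
  have hcover : ∀ y, (∃ x, e x = y) ∨ ∃ l j k, w ((l, j), k) = y := by
    intro y
    by_cases hy : y ∈ range e
    · exact Or.inl hy
    · obtain ⟨⟨⟨l, j⟩, k⟩, hp⟩ : y ∈ range w := h.range_eq ▸ hy
      exact Or.inr ⟨l, j, k, hp⟩
  have hto : ∃ x, Relation.ReflTransGen (ChainStep G ε) y (e x) := by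
    rcases hcover y with ⟨x, rfl⟩ | ⟨l, j, k, rfl⟩
    · exact ⟨x, .refl⟩
    · have := h.eventually_dist_le l k hε (s := fun n => j + n) fun a b hab => by simpa using hab
      obtain ⟨n, hn, h1⟩ := (this.and (eventually_ge_atTop 1)).exists
      obtain ⟨n, rfl⟩ := Nat.exists_eq_add_of_le' h1
      refine ⟨ρ (l, j + (n + 1 : ℕ)), (transGen_chainStep_of_iterate hε.le n
        (p := w ((l, j), k)) ((dist_self _).trans_le hε.le) ?_).to_reflTransGen⟩
      rw [h.iterate]
      exact hn
  have hfrom : ∃ x, Relation.ReflTransGen (ChainStep G ε) (e x) y' := by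
    rcases hcover y' with ⟨x, rfl⟩ | ⟨l, j, k, rfl⟩
    · exact ⟨x, .refl⟩
    · have := h.eventually_dist_le l k hε (s := fun n => j - n) fun a b hab => by simpa using hab
      obtain ⟨n, hn, h1⟩ := (this.and (eventually_ge_atTop 1)).exists
      obtain ⟨n, rfl⟩ := Nat.exists_eq_add_of_le' h1
      refine ⟨ρ (l, j - (n + 1 : ℕ)), (transGen_chainStep_of_iterate hε.le n
        (p := w ((l, j - (n + 1 : ℕ)), k)) ((dist_comm _ _).trans_le hn) ?_).to_reflTransGen⟩
      rw [h.iterate, sub_add_cancel, dist_self]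
      exact hε.le
  obtain ⟨x, hx⟩ := hto
  obtain ⟨x', hx'⟩ := hfrom
  exact ((hX ε hε x x').trans_right hx).trans_left hx'

theorem IsOrbitSystem.transGen_chainStep_link [Nonempty K] (h : IsOrbitSystem e ρ G w)
    {l : L} {a b : X} (ha : ∀ j < 0, ρ (l, j) = a) (hb : ∀ j ≥ 0, ρ (l, j) = b) {ε : ℝ}
    (hε : 0 < ε) : Relation.TransGen (ChainStep G ε) (e a) (e b) := by
  obtain ⟨k⟩ := ‹Nonempty K›
  have h1 := h.eventually_dist_le l k hε (s := fun n => (n : ℤ)) fun a b hab => by simpa using hab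
  have h2 := h.eventually_dist_le l k hε (s := fun n => -(n : ℤ)) fun a b hab => by
    simpa using hab
  obtain ⟨n, ⟨hn1, hn2⟩, hn⟩ := ((h1.and h2).and (eventually_ge_atTop 1)).exists
  -- The orbit runs from time `-n` to time `n`, that is `2n` iterates; `n ≥ 1` makes the truncated
  -- subtraction exact.
  refine transGen_chainStep_of_iterate hε.le (n + n - 1) (p := w ((l, -(n : ℤ)), k)) ?_ ?_
  · rw [dist_comm]
    rwa [ha _ (by omega)] at hn2
  · rw [h.iterate]
    rw [hb _ (by omega)] at hn1
    have : -(n : ℤ) + ((n + n - 1 + 1 : ℕ) : ℤ) = n := by omega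
    rwa [this]

end OrbitSystems

/-! ### Trees with shrinking edges, and chain transitive extensions of the identity -/

theorem exists_nearest_earlier {X : Type*} [MetricSpace X] [CompactSpace X] (a : ℕ → X) :
    ∃ m : ℕ → ℕ, (∀ n, n ≠ 0 → m n < n) ∧
      Tendsto (fun n => dist (a n) (a (m n))) atTop (𝓝 0) := by
  have hex : ∀ n, ∃ m, n ≠ 0 → m < n ∧ ∀ k < n, dist (a n) (a m) ≤ dist (a n) (a k) := by
    intro n
    by_cases hn : n = 0
    · exact ⟨0, fun h => (h hn).elim⟩
    · obtain ⟨m, hm, hmin⟩ := Finset.exists_min_image (Finset.range n)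
        (fun k => dist (a n) (a k)) ⟨0, Finset.mem_range.2 (Nat.pos_of_ne_zero hn)⟩
      exact ⟨m, fun _ => ⟨Finset.mem_range.1 hm, fun k hk => hmin k (Finset.mem_range.2 hk)⟩⟩
  choose m hm using hex
  refine ⟨m, fun n hn => (hm n hn).1, ?_⟩
  rw [Metric.tendsto_nhds]
  intro ε hε
  -- Otherwise infinitely many terms would lie at distance at least `ε` from all earlier ones,
  -- against the existence of a Cauchy subsequence.
  by_contra hfr
  rw [not_eventually] at hfr
  obtain ⟨φ, hφ, hφε⟩ := extraction_of_frequently_atTop hfr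
  obtain ⟨x, ψ, hψ, hx⟩ := CompactSpace.tendsto_subseq (a ∘ φ)
  obtain ⟨N, hN⟩ := Metric.cauchySeq_iff'.1 hx.cauchySeq ε hε
  have hlt : φ (ψ N) < φ (ψ (N + 1)) := hφ (hψ N.lt_succ_self)
  apply hφε (ψ (N + 1))
  rw [Real.dist_0_eq_abs, abs_of_nonneg dist_nonneg]
  exact ((hm _ (by omega)).2 _ hlt).trans_lt (hN (N + 1) N.le_succ)

/-- On every extension of `X` with homeomorphic fibres over the isolated points there is a chain
transitive homeomorphism fixing `X`. -/
theorem IsMapRel.exists_isChainTransitive {X Y Z K : Type*} [MetricSpace X] [CompactSpace X]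
    [Nonempty X] [MetricSpace Y] [CompactSpace Y] [MetricSpace Z] [CompactSpace Z]
    [TopologicalSpace K] [Nonempty K] {e : X → Y} {i : X → Z} {π : Y → Z}
    (h : IsMapRel e i π) (hi : IsPointExtension i) (he : IsClosedEmbedding e)
    (hK : ∀ z : Z, IsOpen ({z} : Set Z) → Nonempty (π ⁻¹' {z} ≃ₜ K)) :
    ∃ G : Y ≃ₜ Y, (∀ x, G (e x) = e x) ∧ IsChainTransitive (mapRel G) := by
  let a := TopologicalSpace.denseSeq X
  have ha : DenseRange a := TopologicalSpace.denseRange_denseSeq X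
  obtain ⟨m, hm, hlim⟩ := exists_nearest_earlier a
  -- Each pseudo-orbit is constant except for one jump between times `-1` and `0`, from `a n` to `a
  -- (m n)` or back according to the Boolean. The jump lengths tend to 0 with `n`.
  let ρ : (ℕ × Bool) × ℤ → X := fun q =>
    if (q.1.2 = true ↔ q.2 < 0) then a q.1.1 else a (m q.1.1)
  have hfst : ∀ n (j : ℤ), j < 0 → ρ ((n, true), j) = a n := fun n j hj => by simp [ρ, hj]
  obtain ⟨G, w, hG, hw⟩ := h.exists_isOrbitSystem hi he hK (Homeomorph.refl X) ρ
    (by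
      intro x ε hε
      obtain ⟨n, hn⟩ := ha.exists_dist_lt x hε
      refine infinite_of_injective_forall_mem
        (f := fun k : ℕ => (((n, true), -((k : ℤ) + 1)) : (ℕ × Bool) × ℤ)) ?_ ?_
      · intro k k' hk
        simpa using hk
      · intro k
        rw [mem_ofPred_eq, hfst _ _ (by omega), dist_comm]
        exact hn)
    (by
      rw [Metric.tendsto_nhds]
      intro ε hε
      rw [eventually_cofinite]
      obtain ⟨N, hN⟩ := Metric.tendsto_atTop.1 hlim ε hε
      refine (((finite_Iio N).prod (finite_univ (α := Bool))).prod
        (finite_singleton (-1 : ℤ))).subset ?_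
      rintro ⟨⟨n, b⟩, j⟩ hq
      simp only [mem_prod, mem_Iio, mem_univ, and_true, mem_singleton_iff]
      by_contra hc
      apply hq
      rw [Real.dist_0_eq_abs, abs_of_nonneg dist_nonneg]
      by_cases hj : j = -1
      · have hn : N ≤ n := by
          by_contra hn
          exact hc ⟨by omega, hj⟩
        have := hN n hn
        rw [Real.dist_0_eq_abs, abs_of_nonneg dist_nonneg] at this
        subst hj
        cases b
        · simpa [ρ, dist_comm] using this
        · simpa [ρ] using this
      · have : (j + 1 < 0) ↔ (j < 0) := by omega
        simp only [ρ, this, Homeomorph.refl_apply, id_eq]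
        rwa [dist_self])
  refine ⟨G, hG, hw.isChainTransitive fun ε hε => ?_⟩
  have hnear : ∀ x x', dist (e x) (e x') ≤ ε → ChainStep G ε (e x) (e x') := fun x x' hx =>
    ⟨e x, (dist_self _).trans_le hε.le, by rwa [hG]⟩
  have hlink : ∀ n, Relation.TransGen (ChainStep G ε) (e (a n)) (e (a (m n))) := fun n =>
    hw.transGen_chainStep_link (l := (n, true)) (hfst n)
      (fun j hj => by simp [ρ, not_lt.2 hj]) hε
  have hlink' : ∀ n, Relation.TransGen (ChainStep G ε) (e (a (m n))) (e (a n)) := fun n =>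
    hw.transGen_chainStep_link (l := (n, false)) (fun j hj => by simp [ρ, hj])
      (fun j hj => by simp [ρ, not_lt.2 hj]) hε
  have hzero : ∀ n, Relation.TransGen (ChainStep G ε) (e (a n)) (e (a 0)) ∧
      Relation.TransGen (ChainStep G ε) (e (a 0)) (e (a n)) := by
    intro n
    induction n using Nat.strong_induction_on with
    | _ n ih =>
      rcases eq_or_ne n 0 with rfl | hn
      · have := hnear (a 0) (a 0) ((dist_self _).trans_le hε.le)
        exact ⟨.single this, .single this⟩
      · obtain ⟨h1, h2⟩ := ih (m n) (hm n hn)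
        exact ⟨(hlink n).trans h1, h2.trans (hlink' n)⟩
  intro x x'
  have happrox : ∀ x, ∃ n, dist (e x) (e (a n)) ≤ ε := by
    intro x
    obtain ⟨δ, hδ, hd⟩ := Metric.continuousAt_iff.1 (he.continuous.continuousAt (x := x)) ε hε
    obtain ⟨n, hn⟩ := ha.exists_dist_lt x hδ
    rw [dist_comm] at hn
    exact ⟨n, (dist_comm _ _).trans_le (hd hn).le⟩
  obtain ⟨n, hn⟩ := happrox x
  obtain ⟨n', hn'⟩ := happrox x'
  exact ((hzero n).1.head (hnear _ _ hn)).trans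
    ((hzero n').2.tail (hnear _ _ ((dist_comm _ _).trans_le hn')))

/-! ### Concatenation of chains -/

section Concatenation

theorem exists_seq_of_transGen {X : Type*} {R : X → X → Prop} {x y : X}
    (h : Relation.TransGen R x y) :
    ∃ (l : ℕ) (c : ℕ → X), 0 < l ∧ c 0 = x ∧ c l = y ∧ ∀ t < l, R (c t) (c (t + 1)) := by
  induction h using Relation.TransGen.head_induction_on with
  | @single a hab => exact ⟨1, fun t => if t = 0 then a else y, by simp [hab]⟩
  | @head a b hab _ ih =>
    obtain ⟨l, c, hl, h0, h1, hc⟩ := ih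
    refine ⟨l + 1, fun t => t.casesOn a c, by omega, rfl, h1, ?_⟩
    rintro (_ | t) ht
    · simpa [h0] using hab
    · exact hc t (by omega)

/-- Concatenation of the chains: `s n` is the time at which `a n` is reached and `ν j` the number of
the chain in use at time `j`. -/
theorem exists_seq_of_forall_transGen {X : Type*} {R : ℕ → X → X → Prop} {a : ℕ → X}
    (h : ∀ n, Relation.TransGen (R n) (a n) (a (n + 1))) :
    ∃ (b : ℕ → X) (s ν : ℕ → ℕ), StrictMono s ∧ Tendsto ν atTop atTop ∧
      (∀ n, b (s n) = a n) ∧ ∀ j, R (ν j) (b j) (b (j + 1)) := by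
  choose l c hl h0 h1 hc using fun n => exists_seq_of_transGen (h n)
  let s : ℕ → ℕ := fun n => ∑ k ∈ Finset.range n, l k
  have hs0 : s 0 = 0 := rfl
  have hs1 : ∀ n, s (n + 1) = s n + l n := fun n => Finset.sum_range_succ _ _
  have hs : StrictMono s := strictMono_nat_of_lt_succ fun n => by
    have := hl n
    have := hs1 n
    omega
  let ν : ℕ → ℕ := fun j => Nat.findGreatest (fun n => s n ≤ j) j
  have hν1 : ∀ j, s (ν j) ≤ j := fun j =>
    Nat.findGreatest_spec (P := fun n => s n ≤ j) (Nat.zero_le j) (by simp [hs0])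
  have hν2 : ∀ n j, s n ≤ j → n ≤ ν j := fun n j hj =>
    Nat.le_findGreatest (hs.le_apply.trans hj) hj
  have hν : ∀ n j, s n ≤ j → j < s (n + 1) → ν j = n := by
    intro n j hj hj'
    refine le_antisymm ?_ (hν2 n j hj)
    exact Nat.lt_succ_iff.1 (hs.lt_iff_lt.1 ((hν1 j).trans_lt hj'))
  let b : ℕ → X := fun j => c (ν j) (j - s (ν j))
  have hb : ∀ n, b (s n) = a n := by
    intro n
    simp only [b, hν n (s n) le_rfl (hs n.lt_succ_self), Nat.sub_self, h0]
  refine ⟨b, s, ν, hs, tendsto_atTop.2 fun n => ?_, hb, fun j => ?_⟩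
  · filter_upwards [eventually_ge_atTop (s n)] with j hj using hν2 n j hj
  · have hlt : j < s (ν j + 1) := by
      by_contra hge
      have := hν2 (ν j + 1) j (not_lt.1 hge)
      omega
    have hle := hν1 j
    have hstep := hc (ν j) (j - s (ν j)) (by have := hs1 (ν j); omega)
    have hbj : b (j + 1) = c (ν j) (j - s (ν j) + 1) := by
      rcases lt_or_eq_of_le (Nat.succ_le_iff.2 hlt) with hlt' | heq
      · have : ν (j + 1) = ν j := hν (ν j) (j + 1) (by omega) hlt'
        simp only [b, this]
        congr 1
        omega
      · have h2 : j - s (ν j) + 1 = l (ν j) := by have := hs1 (ν j); omega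
        have heq : j + 1 = s (ν j + 1) := heq
        rw [h2, h1, heq, hb]
    rw [hbj]
    exact hstep

variable {X : Type*} [MetricSpace X] [CompactSpace X]

theorem transGen_dist_lt {f : X → X} (hc : Continuous f) (hf : IsChainTransitive (mapRel f))
    {ε : ℝ} (hε : 0 < ε) (x y : X) : Relation.TransGen (fun u v => dist (f u) v < ε) x y := by
  obtain ⟨δ, hδ, h⟩ := Metric.uniformContinuous_iff.1
    (CompactSpace.uniformContinuous_of_continuous hc) (ε / 2) (half_pos hε)
  refine Relation.TransGen.mono ?_ _ _
    (isChainTransitive_mapRel_iff.1 hf (min (δ / 2) (ε / 2)) (by positivity) x y)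
  rintro u v ⟨p, h1, h2⟩
  have h3 : dist (f u) (f p) < ε / 2 :=
    h ((h1.trans (min_le_left _ _)).trans_lt (half_lt_self hδ))
  have h4 := h2.trans (min_le_right _ _)
  have h5 := dist_triangle (f u) (f p) v
  linarith

theorem transGen_dist_symm_lt (f : X ≃ₜ X) (hf : IsChainTransitive (mapRel f))
    {ε : ℝ} (hε : 0 < ε) (x y : X) :
    Relation.TransGen (fun u v => dist (f.symm u) v < ε) x y := by
  obtain ⟨δ, hδ, h⟩ := Metric.uniformContinuous_iff.1
    (CompactSpace.uniformContinuous_of_continuous f.symm.continuous) ε hε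
  have := Relation.transGen_swap.2 (transGen_dist_lt f.continuous hf hδ y x)
  refine Relation.TransGen.mono ?_ _ _ this
  intro u v huv
  have h1 : dist (f v) u < δ := huv
  have h2 := h h1
  rwa [Homeomorph.symm_apply_apply, dist_comm] at h2

theorem exists_dense_pseudoOrbit [Nonempty X] {f : X → X}
    (hf : ∀ ε > 0, ∀ x y, Relation.TransGen (fun u v => dist (f u) v < ε) x y) :
    ∃ b : ℕ → X, Tendsto (fun n => dist (f (b n)) (b (n + 1))) atTop (𝓝 0) ∧
      ∀ x ε, 0 < ε → ∃ᶠ n in atTop, dist (b n) x < ε := by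
  -- Unpairing makes every term of the dense sequence recur infinitely often.
  let a : ℕ → X := fun n => TopologicalSpace.denseSeq X n.unpair.1
  obtain ⟨b, s, ν, hs, hν, hb, hR⟩ := exists_seq_of_forall_transGen
    (R := fun n u v => dist (f u) v < 1 / ((n : ℝ) + 1)) (a := a)
    fun n => hf _ (by positivity) _ _
  refine ⟨b, squeeze_zero (fun _ => dist_nonneg) (fun n => (hR n).le)
    (tendsto_one_div_add_atTop_nhds_zero_nat.comp hν), fun x ε hε => ?_⟩
  obtain ⟨k, hk⟩ := (TopologicalSpace.denseRange_denseSeq X).exists_dist_lt x hε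
  rw [frequently_atTop]
  intro N
  refine ⟨s (Nat.pair k N), (Nat.right_le_pair k N).trans hs.le_apply, ?_⟩
  rw [hb, dist_comm]
  simpa [a] using hk

theorem exists_dense_int_pseudoOrbit [Nonempty X] (f : X ≃ₜ X)
    (hf : IsChainTransitive (mapRel f)) :
    ∃ ρ : ℤ → X, Tendsto (fun j => dist (f (ρ j)) (ρ (j + 1))) cofinite (𝓝 0) ∧
      (∀ x ε, 0 < ε → ∃ᶠ j in atTop, dist (ρ j) x < ε) ∧
      ∀ x ε, 0 < ε → ∃ᶠ j in atTop, dist (ρ (-j)) x < ε := by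
  obtain ⟨b, hb, hbd⟩ := exists_dense_pseudoOrbit fun ε hε =>
    transGen_dist_lt f.continuous hf hε
  obtain ⟨b', hb', hbd'⟩ := exists_dense_pseudoOrbit fun ε hε =>
    transGen_dist_symm_lt f hf hε
  have hb'' : Tendsto (fun n => dist (f (b' (n + 1))) (b' n)) atTop (𝓝 0) := by
    have h1 := tendsto_uniformity_iff_dist_tendsto_zero
      (f := fun n => (f.symm (b' n), b' (n + 1))) |>.2 hb'
    have h2 := tendsto_uniformity_iff_dist_tendsto_zero.1
      (Tendsto.comp (CompactSpace.uniformContinuous_of_continuous f.continuous) h1)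
    refine h2.congr fun n => ?_
    simp [dist_comm]
  -- Negative times carry a pseudo-orbit of `f.symm` read backwards. The uncontrolled step from `-1`
  -- to `0` is a single index, harmless for a cofinite limit.
  let ρ : ℤ → X := fun j => Int.casesOn j b b'
  refine ⟨ρ, ?_, fun x ε hε => ?_, fun x ε hε => ?_⟩
  · rw [Metric.tendsto_nhds]
    intro ε hε
    obtain ⟨N, hN⟩ := Metric.tendsto_atTop.1 hb ε hε
    obtain ⟨N', hN'⟩ := Metric.tendsto_atTop.1 hb'' ε hε
    rw [eventually_cofinite]
    refine (finite_Icc (-(N' : ℤ) - 2) N).subset ?_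
    intro j hj
    by_contra hjI
    apply hj
    rw [mem_Icc, not_and_or, not_le, not_le] at hjI
    rcases hjI with h | h
    · obtain ⟨n, rfl⟩ : ∃ n : ℕ, j = Int.negSucc (n + 1) := ⟨(-j - 2).toNat, by omega⟩
      exact hN' n (by omega)
    · obtain ⟨n, rfl⟩ : ∃ n : ℕ, j = Int.ofNat n := ⟨j.toNat, by simp; omega⟩
      exact hN n (by simp at h; omega)
  · rw [frequently_atTop]
    intro M
    obtain ⟨n, hn, hd⟩ := frequently_atTop.1 (hbd x ε hε) M.toNat
    exact ⟨Int.ofNat n, by simp; omega, hd⟩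
  · rw [frequently_atTop]
    intro M
    obtain ⟨n, hn, hd⟩ := frequently_atTop.1 (hbd' x ε hε) M.toNat
    refine ⟨(n : ℤ) + 1, by omega, ?_⟩
    have : -((n : ℤ) + 1) = Int.negSucc n := by omega
    rw [this]
    exact hd

end Concatenation

/-! ### Time reversal, transitivity and limit sets of orbit systems -/

section OrbitSystems

variable {X Y L K : Type*} [MetricSpace Y] {e : X → Y} {ρ : L × ℤ → X}
  {w : (L × ℤ) × K → Y}

theorem IsOrbitSystem.symm {G : Y ≃ₜ Y} (h : IsOrbitSystem e ρ G w) :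
    IsOrbitSystem e (fun q : L × ℤ => ρ (q.1, -q.2)) G.symm
      (fun p : (L × ℤ) × K => w ((p.1.1, -p.1.2), p.2)) := by
  let σ : L × ℤ ≃ L × ℤ := (Equiv.refl L).prodCongr (Equiv.neg ℤ)
  refine ⟨fun l j k => ?_, ?_, ?_, fun k => ?_⟩
  · rw [Homeomorph.symm_apply_eq]
    simp only [h.map_orbit]
    congr 3
    omega
  · exact h.injective.comp (σ.prodCongr (Equiv.refl K)).injective
  · rw [← h.range_eq]
    exact (σ.prodCongr (Equiv.refl K)).surjective.range_comp w
  · exact (h.tendsto k).comp σ.injective.tendsto_cofinite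

theorem IsOrbitSystem.isTopTransitive_pmRel [Subsingleton L] [Subsingleton K] {G : Y ≃ₜ Y}
    (h : IsOrbitSystem e ρ G w) (hd : Dense (range e)ᶜ) :
    IsTopTransitive (pmRel (mapRel G)) := by
  have hforw : ∀ (n : ℕ) l j k, (w ((l, j), k), w ((l, j + n), k)) ∈ orbitRel (pmRel (mapRel G)) ∧
      (w ((l, j + n), k), w ((l, j), k)) ∈ orbitRel (pmRel (mapRel G)) := by
    intro n l j k
    induction n with
    | zero =>
      have : (w ((l, j), k), w ((l, j), k)) ∈ pmRel (mapRel G) := Or.inl (Or.inr rfl)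
      simp only [Nat.cast_zero, add_zero]
      exact ⟨.single this, .single this⟩
    | succ n ih =>
      have hstep : G (w ((l, j + n), k)) = w ((l, j + (n + 1 : ℕ)), k) := by
        rw [h.map_orbit, Nat.cast_succ, add_assoc]
      exact ⟨.tail ih.1 (Or.inl (Or.inl hstep)), .head (Or.inr hstep) ih.2⟩
  rw [IsTopTransitive, wanderingRel, ← dense_iff_closure_eq]
  refine (hd.prod hd).mono ?_
  rintro ⟨y, y'⟩ ⟨hy, hy'⟩
  simp only [← h.range_eq] at hy hy'
  obtain ⟨⟨⟨l, j⟩, k⟩, rfl⟩ := hy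
  obtain ⟨⟨⟨l', j'⟩, k'⟩, rfl⟩ := hy'
  obtain rfl := Subsingleton.elim l l'
  obtain rfl := Subsingleton.elim k k'
  rcases le_total j j' with hj | hj
  · obtain ⟨n, rfl⟩ := Int.le.dest hj
    exact (hforw n l j k).1
  · obtain ⟨n, rfl⟩ := Int.le.dest hj
    exact (hforw n l j' k).2

/-- The orbit is asymptotic to its pseudo-orbit, so it accumulates only on X, and everywhere there
by the recurrence of `ρ`. -/
theorem IsOrbitSystem.omegaLimitPt_eq [MetricSpace X] {G : Y → Y} (h : IsOrbitSystem e ρ G w)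
    (he : IsClosedEmbedding e) {l : L}
    (hρ : ∀ x ε, 0 < ε → ∃ᶠ j in atTop, dist (ρ (l, j)) x < ε) (j : ℤ) (k : K) :
    omegaLimitPt G (w ((l, j), k)) = range e := by
  have hlim : ∀ ε > 0, ∀ᶠ n : ℕ in atTop, dist (w ((l, j + n), k)) (e (ρ (l, j + n))) ≤ ε :=
    fun ε hε => h.eventually_dist_le l k hε (s := fun n => j + n) fun a b hab => by
      simpa using hab
  ext z
  rw [omegaLimitPt, mem_omegaLimit_singleton_iff_mapClusterPt,
    Metric.nhds_basis_ball.mapClusterPt_iff_frequently]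
  simp only [h.iterate, Metric.mem_ball]
  constructor
  · intro hz
    rw [← he.isClosed_range.closure_eq, Metric.mem_closure_iff]
    intro ε hε
    obtain ⟨n, h1, h2⟩ := ((hz (ε / 2) (half_pos hε)).and_eventually
      (hlim (ε / 2) (half_pos hε))).exists
    refine ⟨_, mem_range_self (ρ (l, j + n)), ?_⟩
    have := dist_triangle_left z (e (ρ (l, j + n))) (w ((l, j + n), k))
    linarith
  · rintro ⟨x, rfl⟩ ε hε
    obtain ⟨δ, hδ, hd⟩ := Metric.continuousAt_iff.1 (he.continuous.continuousAt (x := x))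
      (ε / 2) (half_pos hε)
    have hfr : ∃ᶠ n : ℕ in atTop, dist (ρ (l, j + n)) x < δ := by
      rw [frequently_atTop]
      intro N
      obtain ⟨J, hJ, hJx⟩ := frequently_atTop.1 (hρ x δ hδ) (j + N)
      refine ⟨(J - j).toNat, by omega, ?_⟩
      have : j + ((J - j).toNat : ℤ) = J := by omega
      rwa [this]
    refine (hfr.and_eventually (hlim (ε / 2) (half_pos hε))).mono ?_
    rintro n ⟨h1, h2⟩
    have h3 := hd h1
    have := dist_triangle (w ((l, j + n), k)) (e (ρ (l, j + n))) (e x)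
    linarith

end OrbitSystems

/-- A chain transitive homeomorphism of `X` extends to every point extension in such a way that
the isolated points form a single orbit, both ends of which accumulate at all of `X`. -/
theorem IsPointExtension.exists_homeomorph {X Z : Type*} [MetricSpace X] [CompactSpace X]
    [Nonempty X] [MetricSpace Z] [CompactSpace Z] {i : X → Z} (hi : IsPointExtension i)
    (f : X ≃ₜ X) (hf : IsChainTransitive (mapRel f)) :
    ∃ F : Z ≃ₜ Z, (∀ x, F (i x) = i (f x)) ∧ IsChainTransitive (mapRel F) ∧
      IsTopTransitive (pmRel (mapRel F)) ∧
      ∀ y, y ∉ range i → omegaLimitPt F y = range i ∧ alphaLimitPt F y = range i := by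
  obtain ⟨ρ, hρ, hρ1, hρ2⟩ := exists_dense_int_pseudoOrbit f hf
  have hie := hi.isClosedEmbedding
  -- A point extension is treated as an extension of itself with one-point fibres, swept out by a
  -- single orbit.
  obtain ⟨F, w, hF, hw⟩ := (isMapRel_id i).exists_isOrbitSystem (L := Unit) (K := Unit) hi hie
    (fun z _ => ⟨(Homeomorph.homeomorphOfUnique ({z} : Set Z) Unit)⟩) f (fun q => ρ q.2)
    (by
      intro x ε hε hfin
      have hfin : {q : Unit × ℤ | dist (ρ q.2) x < ε}.Finite := hfin
      obtain ⟨M, hM⟩ := (hfin.image Prod.snd).bddAbove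
      obtain ⟨j, hj, hjx⟩ := frequently_atTop.1 (hρ1 x ε hε) (M + 1)
      have := hM ⟨((), j), hjx, rfl⟩
      simp only at this
      omega)
    (hρ.comp (Equiv.punitProd ℤ).injective.tendsto_cofinite)
  refine ⟨F, hF, hw.isChainTransitive fun ε hε =>
    transGen_chainStep_map hie.continuous hF hf hε, hw.isTopTransitive_pmRel ?_, ?_⟩
  · rw [← interior_eq_empty_iff_dense_compl]
    exact hie.isClosed_range.isNowhereDense_iff.1 hi.isNowhereDense
  · intro y hy
    obtain ⟨⟨⟨l, j⟩, k⟩, rfl⟩ : y ∈ range w := hw.range_eq ▸ hy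
    refine ⟨hw.omegaLimitPt_eq hie (fun x ε hε => hρ1 x ε hε) j k, ?_⟩
    have := hw.symm.omegaLimitPt_eq hie (l := l) (fun x ε hε => hρ2 x ε hε) (-j) k
    simpa [alphaLimitPt] using this

/-! ### Skew products over the full shift on the alphabet `ℕ → Bool` -/

section SkewProduct

open Classical in
/-- The letter `s` acts as the permutation `t n`, with `n` the first index at which `s` is true,
and trivially when there is none. -/
noncomputable def letterPerm {D : Type*} (t : ℕ → Equiv.Perm D) (s : ℕ → Bool) : Equiv.Perm D :=
  if h : ∃ n, s n = true then t (Nat.find h) else 1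

/-- The skew product of the shift with the permutations attached to the letters. -/
noncomputable def skewShift {D : Type*} (t : ℕ → Equiv.Perm D) :
    D × (ℤ → ℕ → Bool) ≃ D × (ℤ → ℕ → Bool) where
  toFun p := (letterPerm t (p.2 0) p.1, fun j => p.2 (j + 1))
  invFun p := ((letterPerm t (p.2 (-1))).symm p.1, fun j => p.2 (j - 1))
  left_inv p := by simp
  right_inv p := by simp

variable {D : Type*} {t : ℕ → Equiv.Perm D}

theorem exists_letterPerm_eq (t : ℕ → Equiv.Perm D) (n : ℕ) : ∃ s, letterPerm t s = t n := by
  have h : ∃ m, decide (m = n) = true := ⟨n, by simp⟩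
  refine ⟨fun m => decide (m = n), ?_⟩
  rw [letterPerm, dif_pos h]
  congr 1
  exact of_decide_eq_true (Nat.find_spec h)

theorem letterPerm_apply_eq (s : ℕ → Bool) (d : D) :
    letterPerm t s d = d ∨ ∃ n, letterPerm t s d = t n d := by
  rw [letterPerm]
  split_ifs with h
  · exact Or.inr ⟨_, rfl⟩
  · exact Or.inl rfl

/-- Only the first true index acts, and from `N` on the action on `d` is trivial. This local
constancy in the letter makes the skew product continuous. -/
theorem letterPerm_apply_congr {N : ℕ} {d : D} (hN : ∀ n ≥ N, t n d = d) {s s' : ℕ → Bool}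
    (hs : ∀ n < N, s n = s' n) : letterPerm t s d = letterPerm t s' d := by
  classical
  by_cases h : ∃ n < N, s n = true
  · obtain ⟨n, hn, hsn⟩ := h
    have h1 : ∃ n, s n = true := ⟨n, hsn⟩
    have h2 : ∃ n, s' n = true := ⟨n, hs n hn ▸ hsn⟩
    have h3 : Nat.find h1 = Nat.find h2 := by
      have h4 := Nat.find_min' h1 hsn
      have h5 := Nat.find_min' h2 (hs n hn ▸ hsn)
      refine le_antisymm (Nat.find_min' h1 ?_) (Nat.find_min' h2 ?_)
      · rw [hs _ (by omega)]; exact Nat.find_spec h2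
      · rw [← hs _ (by omega)]; exact Nat.find_spec h1
    rw [letterPerm, letterPerm, dif_pos h1, dif_pos h2, h3]
  · have key : ∀ u : ℕ → Bool, (¬ ∃ n < N, u n = true) → letterPerm t u d = d := by
      intro u hu
      rw [letterPerm]
      split_ifs with h1
      · refine hN _ (not_lt.1 fun h2 => hu ⟨_, h2, Nat.find_spec h1⟩)
      · rfl
    rw [key s h, key s']
    rintro ⟨n, hn, hsn⟩
    exact h ⟨n, hn, (hs n hn).trans hsn⟩

theorem continuous_skewShift [TopologicalSpace D] [DiscreteTopology D]
    (ht : ∀ d, ∃ N, ∀ n ≥ N, t n d = d) : Continuous (skewShift t) := by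
  rw [continuous_prod_of_discrete_left]
  intro d
  obtain ⟨N, hN⟩ := ht d
  have h1 : Continuous fun s => letterPerm t s d := by
    rw [continuous_iff_continuousAt]
    intro s
    have hev : ∀ᶠ s' in 𝓝 s, ∀ n < N, s n = s' n := by
      refine (eventually_all_finite (Set.finite_lt_nat N)).2 fun n _ => ?_
      have : Tendsto (fun s' : ℕ → Bool => s' n) (𝓝 s) (𝓝 (s n)) := (continuous_apply n).tendsto s
      rw [nhds_discrete Bool, tendsto_pure] at this
      exact this.mono fun s' h => h.symm
    exact tendsto_nhds_of_eventually_eq (hev.mono fun s' hs' => (letterPerm_apply_congr hN hs').symm)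
  refine Continuous.prodMk (h1.comp (continuous_apply 0)) ?_
  exact continuous_pi fun j => continuous_apply (j + 1)

theorem skewShift_iterate (n : ℕ) (p : D × (ℤ → ℕ → Bool)) :
    ((skewShift t)^[n] p).2 = fun j => p.2 (j + n) := by
  induction n generalizing p with
  | zero => simp
  | succ n ih =>
    rw [Function.iterate_succ_apply, ih]
    ext1 j
    simp only [skewShift, Equiv.coe_fn_mk]
    have : j + n + 1 = j + (n + 1 : ℕ) := by omega
    rw [this]

theorem skewShift_iterate_congr (n : ℕ) (d : D) {ω θ : ℤ → ℕ → Bool}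
    (h : ∀ j : ℤ, 0 ≤ j → j < n → ω j = θ j) :
    ((skewShift t)^[n] (d, ω)).1 = ((skewShift t)^[n] (d, θ)).1 := by
  induction n generalizing d ω θ with
  | zero => rfl
  | succ n ih =>
    rw [Function.iterate_succ_apply, Function.iterate_succ_apply]
    simp only [skewShift, Equiv.coe_fn_mk] at ih ⊢
    rw [h 0 le_rfl (by omega)]
    exact ih _ fun j hj hjn => h (j + 1) (by omega) (by omega)

/-- Between a prescribed past and a prescribed future, a word is inserted whose letters drive `d` to
`d'`. -/
theorem exists_skewShift_connecting {d d' : D}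
    (h : Relation.ReflTransGen (fun a b => ∃ n, t n a = b) d d') (ω ω' : ℤ → ℕ → Bool) :
    ∃ (l : ℕ) (η η' : ℤ → ℕ → Bool), (∀ j < 0, η j = ω j) ∧
      (skewShift t)^[l] (d, η) = (d', η') ∧ ∀ j ≥ 0, η' j = ω' j := by
  induction h using Relation.ReflTransGen.head_induction_on generalizing ω with
  | refl =>
    let η : ℤ → ℕ → Bool := fun j => if j < 0 then ω j else ω' j
    exact ⟨0, η, η, fun j hj => if_pos hj, rfl, fun j hj => if_neg (not_lt.2 hj)⟩
  | @head a b hab _ ih =>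
    obtain ⟨n, rfl⟩ := hab
    obtain ⟨s, hs⟩ := exists_letterPerm_eq t n
    -- A letter read at position 0 sits at `-1` after one shift, so it joins the past of the
    -- remaining word.
    obtain ⟨l, η, η', h1, h2, h3⟩ := ih fun j => if j = -1 then s else ω (j + 1)
    refine ⟨l + 1, fun j => η (j - 1), η', fun j hj => ?_, ?_, h3⟩
    · simp only [h1 (j - 1) (by omega), if_neg (show j - 1 ≠ -1 by omega), sub_add_cancel]
    · rw [Function.iterate_succ_apply, ← h2]
      congr 1
      have h4 : η (0 - 1) = s := by rw [h1 _ (by omega), if_pos (by omega)]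
      simp only [skewShift, Equiv.coe_fn_mk, h4, hs, add_sub_cancel_right]

theorem exists_forall_abs_le_of_mem_nhds {S : Type*} [TopologicalSpace S] {ω : ℤ → S}
    {O : Set (ℤ → S)} (hO : O ∈ 𝓝 ω) :
    ∃ N : ℕ, ∀ θ : ℤ → S, (∀ j, -(N : ℤ) ≤ j → j ≤ N → θ j = ω j) → θ ∈ O := by
  rw [nhds_pi, Filter.mem_pi] at hO
  obtain ⟨I, hI, u, hu, hsub⟩ := hO
  obtain ⟨N, hN⟩ := (hI.image Int.natAbs).bddAbove
  refine ⟨N, fun θ hθ => hsub fun j hj => ?_⟩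
  have := hN ⟨j, hj, rfl⟩
  rw [hθ j (by omega) (by omega)]
  exact mem_of_mem_nhds (hu j)

theorem exists_skewShift_iterate_mem [TopologicalSpace D]
    (h : ∀ a b, Relation.ReflTransGen (fun a b => ∃ n, t n a = b) a b)
    {p q : D × (ℤ → ℕ → Bool)} {U V : Set (D × (ℤ → ℕ → Bool))} (hU : U ∈ 𝓝 p) (hV : V ∈ 𝓝 q) :
    ∃ n, ∃ r ∈ U, (skewShift t)^[n + 1] r ∈ V := by
  obtain ⟨d, ω⟩ := p
  obtain ⟨d', ω'⟩ := q
  obtain ⟨N, hN⟩ := exists_forall_abs_le_of_mem_nhds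
    ((Continuous.prodMk_right d).continuousAt.preimage_mem_nhds hU)
  obtain ⟨M, hM⟩ := exists_forall_abs_le_of_mem_nhds
    ((Continuous.prodMk_right d').continuousAt.preimage_mem_nhds hV)
  -- Starting `M` steps before the target puts all coordinates constrained by `V` in the prescribed
  -- future; likewise `N + 1` initial steps push those constrained by `U` into the past.
  obtain ⟨r, hr⟩ := (skewShift t).surjective.iterate M (d', ω')
  have hr2 := skewShift_iterate (t := t) M r
  rw [hr] at hr2
  obtain ⟨l, η, η', h1, h2, h3⟩ := exists_skewShift_connecting
    (h ((skewShift t)^[N + 1] (d, ω)).1 r.1) (fun j => ω (j + (N + 1 : ℕ))) r.2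
  have hθ : ∀ j : ℤ, j < N + 1 → η (j - (N + 1 : ℕ)) = ω j := by
    intro j hj
    rw [h1 _ (by omega), sub_add_cancel]
  have hstart : (skewShift t)^[N + 1] (d, fun j => η (j - (N + 1 : ℕ))) =
      (((skewShift t)^[N + 1] (d, ω)).1, η) := by
    refine Prod.ext (skewShift_iterate_congr _ _ fun j _ hj => hθ j (by push_cast at hj; exact hj)) ?_
    rw [skewShift_iterate]
    simp
  have hend : (skewShift t)^[M] (r.1, η') = (d', fun j => η' (j + M)) := by
    refine Prod.ext ?_ (skewShift_iterate _ _)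
    have : d' = ((skewShift t)^[M] (r.1, r.2)).1 := by rw [Prod.mk.eta, hr]
    rw [this]
    exact skewShift_iterate_congr _ _ fun j hj _ => h3 j hj
  refine ⟨M + l + N, (d, fun j => η (j - (N + 1 : ℕ))), hN _ fun j _ hj => hθ j (by omega), ?_⟩
  rw [add_assoc, Function.iterate_add_apply, hstart, Function.iterate_add_apply, h2, hend]
  refine hM _ fun j hj _ => ?_
  rw [h3 _ (by omega)]
  exact (congrFun hr2 j).symm

end SkewProduct

/-- On every Cantor set extension of `X` there is a topologically transitive homeomorphism
fixing `X`. -/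
theorem IsMapRel.exists_isTopTransitive {X Y Z C : Type*} [TopologicalSpace X]
    [Nonempty X] [TopologicalSpace Y] [CompactSpace Y] [T2Space Y] [MetricSpace Z]
    [CompactSpace Z] [TopologicalSpace C] (hC : IsCantorSpace C) {e : X → Y} {i : X → Z}
    {π : Y → Z} (h : IsMapRel e i π) (hi : IsPointExtension i) (he : IsClosedEmbedding e)
    (hK : ∀ z : Z, IsOpen ({z} : Set Z) → Nonempty (π ⁻¹' {z} ≃ₜ C)) :
    ∃ G : Y ≃ₜ Y, (∀ x, G (e x) = e x) ∧ IsTopTransitive (mapRel G) := by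
  classical
  obtain ⟨κ⟩ := hC.nonempty_homeomorph_int
  obtain ⟨ψ, hψ, hr, hπ⟩ := h.exists_trivialization (K := ℤ → ℕ → Bool) hi
    fun z hz => (hK z hz).map fun φ => φ.trans κ
  have := hi.countable
  have := hi.infinite
  have := hi.discreteTopology
  obtain ⟨hden⟩ := nonempty_denumerable ↥(range i)ᶜ
  let d : ℕ ≃ ↥(range i)ᶜ := (Denumerable.eqv _).symm
  obtain ⟨m, hm, hlim⟩ := exists_nearest_earlier fun n => (d n : Z)
  -- Transpositions along the edges of the nearest-earlier tree: connectedness reaches every point,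
  -- and shrinking edges fix each given isolated point eventually.
  let t : ℕ → Equiv.Perm ↥(range i)ᶜ := fun n => Equiv.swap (d n) (d (m n))
  have hmove : ∀ n a, t n a ≠ a → (a = d n ∨ a = d (m n)) ∧
      dist (t n a : Z) a = dist (d n : Z) (d (m n)) := by
    intro n a ha
    rcases eq_or_ne a (d n) with rfl | h1
    · simp [t, dist_comm]
    · rcases eq_or_ne a (d (m n)) with rfl | h2
      · simp [t]
      · exact (ha (Equiv.swap_apply_of_ne_of_ne h1 h2)).elim
  have hsmall : ∀ ε > 0, ∃ N, ∀ n ≥ N, dist (d n : Z) (d (m n)) < ε := by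
    intro ε hε
    obtain ⟨N, hN⟩ := eventually_atTop.1 (hlim.eventually_lt_const hε)
    exact ⟨N, hN⟩
  have ht : ∀ a, ∃ N, ∀ n ≥ N, t n a = a := by
    intro a
    obtain ⟨ε, hε, hball⟩ := Metric.isOpen_iff.1 (hi.isolated a a.2) a rfl
    obtain ⟨N, hN⟩ := hsmall ε hε
    refine ⟨N, fun n hn => ?_⟩
    by_contra hne
    have h1 := (hmove n a hne).2.trans_lt (hN n hn)
    exact hne (Subtype.ext (hball h1))
  have hconn : ∀ n, Relation.ReflTransGen (fun a b => ∃ n, t n a = b) (d n) (d 0) ∧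
      Relation.ReflTransGen (fun a b => ∃ n, t n a = b) (d 0) (d n) := by
    intro n
    induction n using Nat.strong_induction_on with
    | _ n ih =>
      rcases eq_or_ne n 0 with rfl | hn
      · exact ⟨.refl, .refl⟩
      · obtain ⟨h1, h2⟩ := ih (m n) (hm n hn)
        exact ⟨h1.head ⟨n, Equiv.swap_apply_left _ _⟩, h2.tail ⟨n, Equiv.swap_apply_right _ _⟩⟩
  have hconn' : ∀ a b, Relation.ReflTransGen (fun a b => ∃ n, t n a = b) a b := by
    intro a b
    obtain ⟨n, rfl⟩ := d.surjective a
    obtain ⟨n', rfl⟩ := d.surjective b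
    exact (hconn n).1.trans (hconn n').2
  -- Uniformity over all letters is what gives continuity at X, since approaching X puts no
  -- constraint on the fibre coordinate.
  have hfin : ∀ ε > 0, {a : ↥(range i)ᶜ | ∃ s, ε ≤ dist (a : Z) (letterPerm t s a)}.Finite := by
    intro ε hε
    obtain ⟨N, hN⟩ := hsmall ε hε
    refine (((finite_Iio N).image d).union ((finite_Iio N).image (d ∘ m))).subset ?_
    rintro a ⟨s, hs⟩
    rcases letterPerm_apply_eq (t := t) s a with h1 | ⟨n, h1⟩
    · rw [h1, dist_self] at hs
      exact absurd hs (not_le.2 hε)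
    · rw [h1, dist_comm] at hs
      have hne : t n a ≠ a := by
        intro h2
        rw [h2, dist_self] at hs
        exact absurd hs (not_le.2 hε)
      obtain ⟨h2, h3⟩ := hmove n a hne
      have hn : n < N := by
        by_contra hn
        have := hN n (not_lt.1 hn)
        linarith
      rcases h2 with rfl | rfl
      · exact Or.inl ⟨n, hn, rfl⟩
      · exact Or.inr ⟨n, hn, rfl⟩
  obtain ⟨G, hGe, hGψ⟩ := h.exists_homeomorph hi he hψ hr hπ (Homeomorph.refl X) (skewShift t)
    (continuous_skewShift ht) <| by
      intro x
      refine tendsto_comap.congr_dist ?_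
      rw [Metric.tendsto_nhds]
      intro ε hε
      have hcof : Tendsto (Prod.fst : ↥(range i)ᶜ × (ℤ → ℕ → Bool) → ↥(range i)ᶜ)
          (comap (fun p : ↥(range i)ᶜ × (ℤ → ℕ → Bool) => (p.1 : Z)) (𝓝 (i x))) cofinite :=
        (tendsto_comap_iff.2 tendsto_comap).mono_right (comap_coe_nhds_le_cofinite x)
      filter_upwards [hcof (hfin ε hε).compl_mem_cofinite] with p hp
      rw [Real.dist_0_eq_abs, abs_of_nonneg dist_nonneg]
      by_contra hge
      exact hp ⟨p.2 0, not_lt.1 hge⟩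
  refine ⟨G, hGe, ?_⟩
  have hdense : Dense (range ψ) := by
    rw [hr, ← interior_eq_empty_iff_dense_compl, eq_empty_iff_forall_notMem]
    intro y hy
    obtain ⟨x, rfl⟩ := interior_subset hy
    have hnh : range e ∈ 𝓝 (e x) := mem_interior_iff_mem_nhds.1 hy
    rw [h.nhds_base hi.isClosedEmbedding.injective] at hnh
    obtain ⟨W, hW, hWe⟩ := mem_comap.1 hnh
    obtain ⟨ε, hε, hball⟩ := Metric.mem_nhds_iff.1 hW
    obtain ⟨a, ha⟩ := (hi.infinite_dist_lt x hε).nonempty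
    have : ψ (a, fun _ _ => true) ∈ range e := hWe (by
      rw [mem_preimage, hπ]
      exact hball ha)
    have h' : ψ (a, fun _ _ => true) ∈ (range e)ᶜ := hr ▸ mem_range_self _
    exact h' this
  have hiter : ∀ n p, (ψ p, ψ ((skewShift t)^[n + 1] p)) ∈ orbitRel (mapRel G) := by
    intro n p
    induction n with
    | zero => exact .single (hGψ p)
    | succ n ih =>
      refine .tail ih ?_
      rw [Function.iterate_succ_apply' _ (n + 1)]
      exact hGψ _
  rw [IsTopTransitive, wanderingRel, ← dense_iff_closure_eq]
  refine Dense.of_closure ((hdense.prod hdense).mono ?_)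
  rintro ⟨_, _⟩ ⟨⟨p, rfl⟩, ⟨q, rfl⟩⟩
  rw [mem_closure_iff_nhds]
  intro W hW
  obtain ⟨U, hU, V, hV, hUV⟩ := mem_nhds_prod_iff.1 hW
  obtain ⟨n, r, hrU, hrV⟩ := exists_skewShift_iterate_mem hconn'
    (hψ.continuous.continuousAt.preimage_mem_nhds hU)
    (hψ.continuous.continuousAt.preimage_mem_nhds hV)
  exact ⟨_, hUV (mk_mem_prod hrU hrV), hiter n r⟩

theorem theorem3p11
    {X Xi Xc XK C K : Type*}
    [MetricSpace X] [CompactSpace X] [Nonempty X]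
    [MetricSpace Xi] [CompactSpace Xi]
    [MetricSpace Xc] [CompactSpace Xc]
    [MetricSpace XK] [CompactSpace XK]
    [TopologicalSpace C] (hC : IsCantorSpace C)
    [TopologicalSpace K] [CompactSpace K] [TopologicalSpace.MetrizableSpace K] [Nonempty K]
    (i : X → Xi) (hi : IsPointExtension i)
    (c : X → Xc) (hc : IsKExtension C c)
    (k : X → XK) (hk : IsKExtension K k) :
    (∀ f : X ≃ₜ X, IsChainTransitive (mapRel f) →
      ∃ F : Xi ≃ₜ Xi, (∀ x, F (i x) = i (f x)) ∧
        IsChainTransitive (mapRel F) ∧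
        IsTopTransitive (pmRel (mapRel F)) ∧
        (∀ y, y ∉ range i → omegaLimitPt F y = range i ∧ alphaLimitPt F y = range i) ∧
        (∃ y, omegaLimitPt F y = range i)) ∧
    (∃ G : Xc ≃ₜ Xc, (∀ x, G (c x) = c x) ∧ IsTopTransitive (mapRel G)) ∧
    (∃ G : XK ≃ₜ XK, (∀ x, G (k x) = k x) ∧ IsChainTransitive (mapRel G)) := by
  refine ⟨fun f hf => ?_, ?_, ?_⟩
  · obtain ⟨F, h1, h2, h3, h4⟩ := hi.exists_homeomorph f hf
    obtain ⟨y⟩ := hi.infinite.nonempty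
    exact ⟨F, h1, h2, h3, h4, y, (h4 y y.2).1⟩
  · obtain ⟨he, Z, _, _, _, j, π, hj, hπ, hK⟩ := hc
    let _ := TopologicalSpace.metrizableSpaceMetric Z
    exact hπ.exists_isTopTransitive hC hj he hK
  · obtain ⟨he, Z, _, _, _, j, π, hj, hπ, hK⟩ := hk
    let _ := TopologicalSpace.metrizableSpaceMetric Z
    exact hπ.exists_isChainTransitive hj he hK
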